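/- Let $I\subset\mathbb R$ be a nonempty open interval and let $J\subset(0,\pi)$ be a nonempty open interval with $\pi/2\notin J$. Use canonical spherical coordinates $(\varphi,\theta,p_\varphi,p_\theta)$, $\varphi\in I$, $\theta\in J$, on $T^*\mathbb S^2$. Let $$P=\begin{pmatrix}0&\mathrm I\\-\mathrm I&0\end{pmatrix}$$ be the canonical Poisson bivector, so $\{\varphi,p_\varphi\}=\{\theta,p_\theta\}=1$, and let $Z=(Z_T,0)^{\top}$ with $$Z_T=\begin{pmatrix}\Bigl(\dfrac1{\cos\theta}+\ln\dfrac{1-\cos\theta}{\sin\theta}\Bigr)p_\varphi p_\theta\\[2mm] \dfrac12\ln\dfrac{1-\cos\theta}{\sin\theta}\,p_\varphi^2+\dfrac1{2\cos\theta}\,p_\theta^2\end{pmatrix},\qquad P_\lambda=P+\lambda\,\mathcal L_ZP .$$ Consider $Y=(0,Y_V)^{\top}$ with $$Y_V=A(\varphi,\theta)\begin{pmatrix}p_\varphi\\p_\theta\end{pmatrix}+h(\varphi,\theta),$$ where $A$ is a real $2\times2$ matrix and $h=(h_1,h_2)^\top$ a real vector, both with $C^\infty$ entries on $I\times J$. Then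 $\widetilde P_\lambda=P_\lambda+\lambda\,\mathcal L_YP$ is a Poisson bivector, i.e. the Schouten bracket $[\![\widetilde P_\lambda,\widetilde P_\lambda]\!]$ vanishes, for all $\lambda\in\mathbb R$ if and only if $\partial_\theta h_1=\partial_\varphi h_2$ (equivalently, the field $(0,h)$ contributes nothing to $\mathcal L_YP$) and there is a constant $\kappa\in\mathbb R$ (the field $(0,\kappa p)$ only adds the multiple $-\kappa P$ of $P$ to $\mathcal L_YP$) such that one of the following holds: (1) there are a $C^\infty$ function $f$ on $I$ and a constant $c_1\in\mathbb R$ with $$A\begin{pmatrix}p_\varphi\\p_\theta\end{pmatrix}=\kappa\begin{pmatrix}p_\varphi\\p_\theta\end{pmatrix}+Y_V^{(1)},\qquad Y_V^{(1)}=\begin{pmatrix}\dfrac{f'(\varphi)}{\cos\theta}\\[2mm]\dfrac{c_1-f(\varphi)}{\sin\theta}\end{pmatrix}p_\theta\qquad\text{on } I\times J;$$ (2) there are constants $\alpha,c_1,c_2,c_3\in\mathbb R$ such that, at all points of $I\times J$ with $\cos(\varphi+\alpha)\neq0$, $$A\begin{pmatrix}p_\varphi\\p_\theta\end{pmatrix}=\kappa\begin{pmatrix}p_\varphi\\p_\theta\end{pmatrix}+Y_V^{(2)}\big|_{\varphi\to\varphi+\alpha},$$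 where $$Y_V^{(2)}=c_1\begin{pmatrix}\sin\varphi\,p_\varphi-\cos\varphi\tan\theta\,p_\theta\\[1mm]-\cos\varphi\cot\theta\,p_\varphi-\sin\varphi\,p_\theta\end{pmatrix}+\frac{c_2\,p_\theta}{\cos^2\varphi}\begin{pmatrix}\dfrac{\tan\varphi}{\cos\theta}\\[2mm]-\dfrac1{2\sin\theta}\end{pmatrix}+\frac{c_3\,p_\theta}{\cos^2\varphi}\begin{pmatrix}\dfrac{\cos^2\varphi-2}{\cos\varphi\cos\theta}\\[2mm]\dfrac{\sin\varphi}{\sin\theta}\end{pmatrix}.$$ -/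

import Mathlib

open scoped ContDiff

noncomputable section

namespace KowPencil

/-- Phase space in the spherical chart, with coordinates `z = (φ, θ, p_φ, p_θ)`. -/
abbrev Phase : Type := Fin 4 → ℝ

/-- A vector field, given by its components in the coordinates of `Phase`. -/
abbrev VectorField : Type := Phase → Fin 4 → ℝ

/-- A contravariant 2-tensor field, given by its components `P i j = {z_i, z_j}`. -/
abbrev BivectorField : Type := Phase → Matrix (Fin 4) (Fin 4) ℝ

/-- The partial derivative `∂F/∂z_m`. -/
def pderiv (m : Fin 4) (F : Phase → ℝ) (z : Phase) : ℝ :=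
  fderiv ℝ F z (Pi.single m 1)

/-- The Schouten bracket of two bivectors, in components:
`⟦P, Q⟧_{ijk} = - ∑_m (Q_{mk} ∂_m P_{ij} + P_{mk} ∂_m Q_{ij} + cycle (i, j, k))`. -/
def schouten (P Q : BivectorField) (z : Phase) (i j k : Fin 4) : ℝ :=
  -∑ m : Fin 4,
    ((Q z m k * pderiv m (fun w => P w i j) z + P z m k * pderiv m (fun w => Q w i j) z)
      + (Q z m i * pderiv m (fun w => P w j k) z + P z m i * pderiv m (fun w => Q w j k) z)
      + (Q z m j * pderiv m (fun w => P w k i) z + P z m j * pderiv m (fun w => Q w k i) z))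

/-- `P` is a (smooth) Poisson bivector on the open set `D`. -/
def IsPoissonOn (D : Set Phase) (P : BivectorField) : Prop :=
  (∀ i j, ContDiffOn ℝ ∞ (fun z => P z i j) D) ∧
  (∀ z ∈ D, ∀ i j, P z j i = -P z i j) ∧
  (∀ z ∈ D, ∀ i j k, schouten P P z i j k = 0)

/-- The Lie derivative `L_Y P` of a contravariant 2-tensor `P` along the vector field `Y`. -/
def lieDeriv (Y : VectorField) (P : BivectorField) : BivectorField :=
  fun z => Matrix.of fun i j =>
    ∑ m : Fin 4, (Y z m * pderiv m (fun w => P w i j) z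
      - P z m j * pderiv m (fun w => Y w i) z
      - P z i m * pderiv m (fun w => Y w j) z)

/-- The canonical Poisson bivector of `T*S²`: `{φ, p_φ} = {θ, p_θ} = 1`. -/
def canonicalBivector : BivectorField :=
  fun _ => !![0, 0, 1, 0; 0, 0, 0, 1; -1, 0, 0, 0; 0, -1, 0, 0]

/-- The kinetic vector field `Z = (Z_T, 0)`. -/
def kineticField : VectorField := fun z =>
  ![(1 / Real.cos (z 1) + Real.log ((1 - Real.cos (z 1)) / Real.sin (z 1))) * z 2 * z 3,
    1 / 2 * Real.log ((1 - Real.cos (z 1)) / Real.sin (z 1)) * z 2 ^ 2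
      + 1 / (2 * Real.cos (z 1)) * z 3 ^ 2,
    0,
    0]

/-- The vector field `Y = (0, Y_V)` with `Y_V = A(φ, θ) (p_φ, p_θ)ᵀ + h(φ, θ)`. -/
def potentialField (A : ℝ × ℝ → Matrix (Fin 2) (Fin 2) ℝ) (h : ℝ × ℝ → Fin 2 → ℝ) :
    VectorField := fun z =>
  ![0,
    0,
    A (z 0, z 1) 0 0 * z 2 + A (z 0, z 1) 0 1 * z 3 + h (z 0, z 1) 0,
    A (z 0, z 1) 1 0 * z 2 + A (z 0, z 1) 1 1 * z 3 + h (z 0, z 1) 1]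

/-- The kinetic Poisson pencil `P_l = P + l L_Z P`. -/
def kineticPencil (l : ℝ) : BivectorField :=
  fun z => canonicalBivector z + l • lieDeriv kineticField canonicalBivector z

/-- The deformed pencil `P_l + l L_Y P`. -/
def deformedPencil (Y : VectorField) (l : ℝ) : BivectorField :=
  fun z => kineticPencil l z + l • lieDeriv Y canonicalBivector z

/-- The part of the phase space that lies over the coordinate rectangle `φ ∈ I`, `θ ∈ J`. -/
def phaseOver (I J : Set ℝ) : Set Phase := {z | z 0 ∈ I ∧ z 1 ∈ J}

/-- Coefficient matrix of the first family,
`Y_V = (f'(φ) / cos θ, (c₁ - f(φ)) / sin θ)ᵀ p_θ`. -/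
def familyOne (f : ℝ → ℝ) (c₁ : ℝ) (q : ℝ × ℝ) : Matrix (Fin 2) (Fin 2) ℝ :=
  !![0, deriv f q.1 / Real.cos q.2;
     0, (c₁ - f q.1) / Real.sin q.2]

/-- Coefficient matrix of the second family. -/
def familyTwo (c₁ c₂ c₃ : ℝ) (q : ℝ × ℝ) : Matrix (Fin 2) (Fin 2) ℝ :=
  c₁ • !![Real.sin q.1, -(Real.cos q.1 * Real.tan q.2);
          -(Real.cos q.1 * Real.cot q.2), -Real.sin q.1]
  + (c₂ / Real.cos q.1 ^ 2) •
      !![0, Real.tan q.1 / Real.cos q.2;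
         0, -(1 / (2 * Real.sin q.2))]
  + (c₃ / Real.cos q.1 ^ 2) •
      !![0, (Real.cos q.1 ^ 2 - 2) / (Real.cos q.1 * Real.cos q.2);
         0, Real.sin q.1 / Real.sin q.2]

end KowPencil

end

/-!
The Lie derivatives `L_Z P` and `L_Y P` are computed in coordinates: all logarithms of `Z` cancel,
and the entries of the pencil are polynomials of degree at most two in the momenta whose
coefficients are functions of `(φ, θ)` (`explicitPencil`, `deformedPencil_eq_explicitPencil`). The
Schouten square is `l²` times four such polynomials (`schouten_explicitPencil`), so the Poisson
condition for all `l`, and already for `l = 1`, is a system of linear and quadratic differential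
equations for `h` and for the entries `a, b, d, e` of `A`.

One coefficient is the curl of `h`. Among the others, `∂_θ a = 0`, `d = -a' cot θ` and
`a''' = -a'` (`PencilEquations`), so `a = κ + w` with `w'' = -w`. An integration in `θ` then gives
`e = κ - w + E(φ) / sin θ` and `b = -w' tan θ - E' / cos θ` (`exists_normalForm`), and the only
condition left is `w' E'' - 3 w E' - 2 w' E = 0`; conversely every such normal form solves the
whole system (`schouten_explicitPencil_eq_zero`).

If `w = 0`, the function `E` is arbitrary, which is the first family. Otherwise
`w = c₁ sin (φ + α)`, and with `X = φ + α` the quantities `E' cos X - 2 E sin X` and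
`E cos² X - c₃ sin X` are constant, which is the second family (`exists_first_integrals`). These
first integrals are regular where `cos X = 0`, so the constants do not jump there. In the converse
direction, the Schouten square vanishes where `cos X ≠ 0`, hence everywhere by continuity
(`schouten_eq_zero_of_cos_ne_zero`).
-/

noncomputable section

namespace KowPencil

open Filter Topology

/-! ### Partial derivatives and Schouten squares in coordinates -/

/-- The partial derivative with respect to the first coordinate of the plane. -/
def dx (F : ℝ × ℝ → ℝ) (q : ℝ × ℝ) : ℝ := fderiv ℝ F q (1, 0)

/-- The partial derivative with respect to the second coordinate of the plane. -/
def dy (F : ℝ × ℝ → ℝ) (q : ℝ × ℝ) : ℝ := fderiv ℝ F q (0, 1)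

theorem hasDerivAt_dx {F : ℝ × ℝ → ℝ} {x y : ℝ} (hF : DifferentiableAt ℝ F (x, y)) :
    HasDerivAt (fun t => F (t, y)) (dx F (x, y)) x :=
  hF.hasFDerivAt.comp_hasDerivAt x ((hasDerivAt_id x).prodMk (hasDerivAt_const x y))

theorem hasDerivAt_dy {F : ℝ × ℝ → ℝ} {x y : ℝ} (hF : DifferentiableAt ℝ F (x, y)) :
    HasDerivAt (fun t => F (x, t)) (dy F (x, y)) y :=
  hF.hasFDerivAt.comp_hasDerivAt y ((hasDerivAt_const y x).prodMk (hasDerivAt_id y))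

theorem dx_eq {F : ℝ × ℝ → ℝ} {x y v : ℝ} (hF : DifferentiableAt ℝ F (x, y))
    (h : HasDerivAt (fun t => F (t, y)) v x) : dx F (x, y) = v :=
  (hasDerivAt_dx hF).unique h

theorem dy_eq {F : ℝ × ℝ → ℝ} {x y v : ℝ} (hF : DifferentiableAt ℝ F (x, y))
    (h : HasDerivAt (fun t => F (x, t)) v y) : dy F (x, y) = v :=
  (hasDerivAt_dy hF).unique h

theorem contDiffOn_dx {F : ℝ × ℝ → ℝ} {U : Set (ℝ × ℝ)} (hU : IsOpen U)
    (hF : ContDiffOn ℝ ∞ F U) : ContDiffOn ℝ ∞ (dx F) U :=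
  (hF.fderiv_of_isOpen hU (by simp)).clm_apply contDiffOn_const

theorem contDiffOn_dy {F : ℝ × ℝ → ℝ} {U : Set (ℝ × ℝ)} (hU : IsOpen U)
    (hF : ContDiffOn ℝ ∞ F U) : ContDiffOn ℝ ∞ (dy F) U :=
  (hF.fderiv_of_isOpen hU (by simp)).clm_apply contDiffOn_const

theorem dx_zero (q : ℝ × ℝ) : dx (fun _ => 0) q = 0 := by simp [dx]

theorem dy_zero (q : ℝ × ℝ) : dy (fun _ => 0) q = 0 := by simp [dy]

theorem dx_neg (F : ℝ × ℝ → ℝ) (q : ℝ × ℝ) : dx (fun r => -F r) q = -dx F q := by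
  simp [dx]

theorem dy_neg (F : ℝ × ℝ → ℝ) (q : ℝ × ℝ) : dy (fun r => -F r) q = -dy F q := by
  simp [dy]

theorem differentiableAt_comp_snd {g : ℝ → ℝ} {g' : ℝ} {q : ℝ × ℝ} (hg : HasDerivAt g g' q.2) :
    DifferentiableAt ℝ (fun r : ℝ × ℝ => g r.2) q :=
  hg.differentiableAt.comp q differentiableAt_snd

theorem dx_comp_snd {g : ℝ → ℝ} {g' : ℝ} {q : ℝ × ℝ} (hg : HasDerivAt g g' q.2) :
    dx (fun r => g r.2) q = 0 :=
  dx_eq (differentiableAt_comp_snd hg) (hasDerivAt_const q.1 (g q.2))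

theorem dy_comp_snd {g : ℝ → ℝ} {g' : ℝ} {q : ℝ × ℝ} (hg : HasDerivAt g g' q.2) :
    dy (fun r => g r.2) q = g' :=
  dy_eq (differentiableAt_comp_snd hg) hg

/-- The function on phase space that is a polynomial of degree at most two in the momenta, with
the given functions of the positions as coefficients. -/
def quad (g₀ g₂ g₃ g₂₂ g₂₃ g₃₃ : ℝ × ℝ → ℝ) (z : Phase) : ℝ :=
  g₀ (z 0, z 1) + g₂ (z 0, z 1) * z 2 + g₃ (z 0, z 1) * z 3
    + g₂₂ (z 0, z 1) * z 2 ^ 2 + g₂₃ (z 0, z 1) * (z 2 * z 3) + g₃₃ (z 0, z 1) * z 3 ^ 2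

/-- The projection of phase space onto the positions `(φ, θ)`. -/
def position : Phase →L[ℝ] ℝ × ℝ :=
  (ContinuousLinearMap.proj 0).prod (ContinuousLinearMap.proj 1)

section quad

variable {g₀ g₂ g₃ g₂₂ g₂₃ g₃₃ : ℝ × ℝ → ℝ}

theorem contDiffOn_quad {D : Set Phase} {U : Set (ℝ × ℝ)} (hD : ∀ z ∈ D, (z 0, z 1) ∈ U)
    (h₀ : ContDiffOn ℝ ∞ g₀ U) (h₂ : ContDiffOn ℝ ∞ g₂ U) (h₃ : ContDiffOn ℝ ∞ g₃ U)
    (h₂₂ : ContDiffOn ℝ ∞ g₂₂ U) (h₂₃ : ContDiffOn ℝ ∞ g₂₃ U) (h₃₃ : ContDiffOn ℝ ∞ g₃₃ U) :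
    ContDiffOn ℝ ∞ (quad g₀ g₂ g₃ g₂₂ g₂₃ g₃₃) D := by
  have key : ∀ g : ℝ × ℝ → ℝ, ContDiffOn ℝ ∞ g U →
      ContDiffOn ℝ ∞ (fun z : Phase => g (z 0, z 1)) D := fun g hg =>
    hg.comp (s := D) position.contDiff.contDiffOn hD
  have c2 : ContDiffOn ℝ ∞ (fun z : Phase => z 2) D := (contDiff_apply ℝ ℝ 2).contDiffOn
  have c3 : ContDiffOn ℝ ∞ (fun z : Phase => z 3) D := (contDiff_apply ℝ ℝ 3).contDiffOn
  exact (((((key _ h₀).add ((key _ h₂).mul c2)).add ((key _ h₃).mul c3)).add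
    ((key _ h₂₂).mul (c2.pow 2))).add ((key _ h₂₃).mul (c2.mul c3))).add
    ((key _ h₃₃).mul (c3.pow 2))

theorem hasFDerivAt_comp_position {g : ℝ × ℝ → ℝ} {z : Phase}
    (hg : DifferentiableAt ℝ g (z 0, z 1)) :
    HasFDerivAt (fun w : Phase => g (w 0, w 1)) ((fderiv ℝ g (z 0, z 1)).comp position) z :=
  HasFDerivAt.comp (g := g) (f := position) z hg.hasFDerivAt position.hasFDerivAt

/-- The derivative of `quad` as one linear map, together with its values on the coordinate
directions. -/
theorem hasFDerivAt_quad {z : Phase}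
    (h₀ : DifferentiableAt ℝ g₀ (z 0, z 1)) (h₂ : DifferentiableAt ℝ g₂ (z 0, z 1))
    (h₃ : DifferentiableAt ℝ g₃ (z 0, z 1)) (h₂₂ : DifferentiableAt ℝ g₂₂ (z 0, z 1))
    (h₂₃ : DifferentiableAt ℝ g₂₃ (z 0, z 1)) (h₃₃ : DifferentiableAt ℝ g₃₃ (z 0, z 1)) :
    ∃ L : Phase →L[ℝ] ℝ, HasFDerivAt (quad g₀ g₂ g₃ g₂₂ g₂₃ g₃₃) L z ∧
      L (Pi.single 0 1) = quad (dx g₀) (dx g₂) (dx g₃) (dx g₂₂) (dx g₂₃) (dx g₃₃) z ∧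
      L (Pi.single 1 1) = quad (dy g₀) (dy g₂) (dy g₃) (dy g₂₂) (dy g₂₃) (dy g₃₃) z ∧
      L (Pi.single 2 1) = g₂ (z 0, z 1) + 2 * g₂₂ (z 0, z 1) * z 2 + g₂₃ (z 0, z 1) * z 3 ∧
      L (Pi.single 3 1) = g₃ (z 0, z 1) + g₂₃ (z 0, z 1) * z 2 + 2 * g₃₃ (z 0, z 1) * z 3 := by
  have c2 : HasFDerivAt (fun w : Phase => w 2)
      (ContinuousLinearMap.proj (R := ℝ) (φ := fun _ : Fin 4 => ℝ) 2) z := hasFDerivAt_apply 2 z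
  have c3 : HasFDerivAt (fun w : Phase => w 3)
      (ContinuousLinearMap.proj (R := ℝ) (φ := fun _ : Fin 4 => ℝ) 3) z := hasFDerivAt_apply 3 z
  refine ⟨_, ((((((hasFDerivAt_comp_position h₀).add
    ((hasFDerivAt_comp_position h₂).mul c2)).add ((hasFDerivAt_comp_position h₃).mul c3)).add
    ((hasFDerivAt_comp_position h₂₂).mul (c2.pow 2))).add
    ((hasFDerivAt_comp_position h₂₃).mul (c2.mul c3))).add
    ((hasFDerivAt_comp_position h₃₃).mul (c3.pow 2))), ?_, ?_, ?_, ?_⟩ <;>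
  simp [position, quad, dx, dy, Prod.mk_zero_zero] <;> ring

theorem pderiv_quad {z : Phase}
    (h₀ : DifferentiableAt ℝ g₀ (z 0, z 1)) (h₂ : DifferentiableAt ℝ g₂ (z 0, z 1))
    (h₃ : DifferentiableAt ℝ g₃ (z 0, z 1)) (h₂₂ : DifferentiableAt ℝ g₂₂ (z 0, z 1))
    (h₂₃ : DifferentiableAt ℝ g₂₃ (z 0, z 1)) (h₃₃ : DifferentiableAt ℝ g₃₃ (z 0, z 1)) :
    pderiv 0 (quad g₀ g₂ g₃ g₂₂ g₂₃ g₃₃) z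
        = quad (dx g₀) (dx g₂) (dx g₃) (dx g₂₂) (dx g₂₃) (dx g₃₃) z ∧
      pderiv 1 (quad g₀ g₂ g₃ g₂₂ g₂₃ g₃₃) z
        = quad (dy g₀) (dy g₂) (dy g₃) (dy g₂₂) (dy g₂₃) (dy g₃₃) z ∧
      pderiv 2 (quad g₀ g₂ g₃ g₂₂ g₂₃ g₃₃) z
        = g₂ (z 0, z 1) + 2 * g₂₂ (z 0, z 1) * z 2 + g₂₃ (z 0, z 1) * z 3 ∧
      pderiv 3 (quad g₀ g₂ g₃ g₂₂ g₂₃ g₃₃) z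
        = g₃ (z 0, z 1) + g₂₃ (z 0, z 1) * z 2 + 2 * g₃₃ (z 0, z 1) * z 3 := by
  obtain ⟨L, hL, hL'⟩ := hasFDerivAt_quad h₀ h₂ h₃ h₂₂ h₂₃ h₃₃
  simpa only [pderiv, hL.fderiv] using hL'

end quad

/-- The skew-symmetric tensor field with the given components above the diagonal. -/
def skewField (q₀₁ q₀₂ q₀₃ q₁₂ q₁₃ q₂₃ : Phase → ℝ) : BivectorField := fun z =>
  !![0, q₀₁ z, q₀₂ z, q₀₃ z;
     -q₀₁ z, 0, q₁₂ z, q₁₃ z;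
     -q₀₂ z, -q₁₂ z, 0, q₂₃ z;
     -q₀₃ z, -q₁₃ z, -q₂₃ z, 0]

theorem pderiv_neg (m : Fin 4) (F : Phase → ℝ) (z : Phase) :
    pderiv m (fun w => -F w) z = -pderiv m F z := by
  simp [pderiv]

theorem pderiv_const (m : Fin 4) (c : ℝ) (z : Phase) : pderiv m (fun _ => c) z = 0 := by
  simp [pderiv]

theorem pderiv_const_add_const_mul (m : Fin 4) (c l : ℝ) (F : Phase → ℝ) (z : Phase) :
    pderiv m (fun w => c + l * F w) z = l * pderiv m F z := by
  have : (fun w => c + l * F w) = fun w => c + (l • F) w := by ext; simp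
  rw [pderiv, this, fderiv_const_add, fderiv_const_smul_field]
  simp [pderiv]

theorem pderiv_congr {m : Fin 4} {F G : Phase → ℝ} {z : Phase} (h : F =ᶠ[𝓝 z] G) :
    pderiv m F z = pderiv m G z := by
  rw [pderiv, h.fderiv_eq, pderiv]

theorem schouten_cycle (P : BivectorField) (z : Phase) (i j k : Fin 4) :
    schouten P P z i j k = schouten P P z j k i := by
  simp only [schouten, neg_inj]
  exact Finset.sum_congr rfl fun m _ => by ring

theorem schouten_swap {P : BivectorField} (hP : ∀ z i j, P z j i = -P z i j)
    (z : Phase) (i j k : Fin 4) : schouten P P z j i k = -schouten P P z i j k := by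
  have hd : ∀ m a b, pderiv m (fun w => P w b a) z = -pderiv m (fun w => P w a b) z := by
    intro m a b
    simp only [hP _ a b, pderiv_neg]
  simp only [schouten, ← Finset.sum_neg_distrib]
  refine Finset.sum_congr rfl fun m _ => ?_
  rw [hd m i j, hd m j k, hd m k i]
  ring

/-- The Schouten square of a bivector is totally skew-symmetric, so it vanishes as soon as its
four components with increasing indices do. -/
theorem schouten_eq_zero_of_skew {P : BivectorField} (hP : ∀ z i j, P z j i = -P z i j)
    {z : Phase} (h₀₁₂ : schouten P P z 0 1 2 = 0) (h₀₁₃ : schouten P P z 0 1 3 = 0)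
    (h₀₂₃ : schouten P P z 0 2 3 = 0) (h₁₂₃ : schouten P P z 1 2 3 = 0) (i j k : Fin 4) :
    schouten P P z i j k = 0 := by
  have hc := schouten_cycle P z
  have hs := schouten_swap hP z
  generalize schouten P P z = T at *
  have hd : ∀ a b, T a a b = 0 := fun a b => by linarith [hs a a b]
  have key : ∀ a b c, T a b c = 0 →
      T b c a = 0 ∧ T c a b = 0 ∧ T b a c = 0 ∧
      T a c b = 0 ∧ T c b a = 0 := by
    intro a b c h
    have h1 := hc a b c
    have h2 := hc b c a
    have h3 := hs a b c
    have h4 := hs b c a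
    have h5 := hs c a b
    refine ⟨by linarith, by linarith, by linarith, by linarith, by linarith⟩
  have hd' : ∀ a b, T a b a = 0 := fun a b => (key a a b (hd a b)).2.2.2.1
  have hd'' : ∀ a b, T b a a = 0 := fun a b => (key a a b (hd a b)).2.1
  have k₁ := key _ _ _ h₀₁₂
  have k₂ := key _ _ _ h₀₁₃
  have k₃ := key _ _ _ h₀₂₃
  have k₄ := key _ _ _ h₁₂₃
  fin_cases i <;> fin_cases j <;> fin_cases k <;>
    first
      | exact hd _ _
      | exact hd' _ _
      | exact hd'' _ _
      | assumption
      | exact k₁.1 | exact k₁.2.1 | exact k₁.2.2.1 | exact k₁.2.2.2.1 | exact k₁.2.2.2.2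
      | exact k₂.1 | exact k₂.2.1 | exact k₂.2.2.1 | exact k₂.2.2.2.1 | exact k₂.2.2.2.2
      | exact k₃.1 | exact k₃.2.1 | exact k₃.2.2.1 | exact k₃.2.2.2.1 | exact k₃.2.2.2.2
      | exact k₄.1 | exact k₄.2.1 | exact k₄.2.2.1 | exact k₄.2.2.2.1 | exact k₄.2.2.2.2

theorem schouten_congr {P Q : BivectorField} {z : Phase} (h : P =ᶠ[𝓝 z] Q) (i j k : Fin 4) :
    schouten P P z i j k = schouten Q Q z i j k := by
  have hd : ∀ m a b, pderiv m (fun w => P w a b) z = pderiv m (fun w => Q w a b) z :=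
    fun m a b => pderiv_congr (h.mono fun w hw => by simp only [hw])
  simp only [schouten, hd, h.self_of_nhds]

/-! ### The pencil in coordinates and its Schouten square -/

section pencil

variable (A : ℝ × ℝ → Matrix (Fin 2) (Fin 2) ℝ) (h : ℝ × ℝ → Fin 2 → ℝ)

/-- The coefficient of `p_φ` in the component `{p_φ, p_θ}` of `L_Y P`. -/
def curlLeft : ℝ × ℝ → ℝ := fun q => dx (fun r => A r 1 0) q - dy (fun r => A r 0 0) q

/-- The coefficient of `p_θ` in the component `{p_φ, p_θ}` of `L_Y P`. -/
def curlRight : ℝ × ℝ → ℝ := fun q => dx (fun r => A r 1 1) q - dy (fun r => A r 0 1) q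

/-- The curl of `h`, which is the momentum-free part of the component `{p_φ, p_θ}` of `L_Y P`. -/
def curlForce : ℝ × ℝ → ℝ := fun q => dx (fun r => h r 1) q - dy (fun r => h r 0) q

/-- The coordinate expression of `P + l (L_Z P + L_Y P)`, free of the logarithms of `Z`. The
summands `0` and `1` are the components of `P`; they are written out to give all entries one shape. -/
def explicitPencil (l : ℝ) : BivectorField :=
  skewField
    (fun z => 0 + l * quad (fun _ => 0) (fun q => (Real.cos q.2)⁻¹) (fun _ => 0) (fun _ => 0)
      (fun _ => 0) (fun _ => 0) z)
    (fun z => 1 + l * quad (fun q => -A q 0 0) (fun _ => 0) (fun _ => 0) (fun _ => 0)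
      (fun _ => 0) (fun _ => 0) z)
    (fun z => 0 + l * quad (fun q => -A q 1 0) (fun _ => 0) (fun _ => 0) (fun _ => 0)
      (fun q => -(Real.cos q.2 ^ 2 * Real.sin q.2)⁻¹) (fun _ => 0) z)
    (fun z => 0 + l * quad (fun q => -A q 0 1) (fun _ => 0) (fun _ => 0) (fun _ => 0)
      (fun _ => 0) (fun _ => 0) z)
    (fun z => 1 + l * quad (fun q => -A q 1 1) (fun _ => 0) (fun _ => 0)
      (fun q => -(2 * Real.sin q.2)⁻¹) (fun _ => 0)
      (fun q => -(Real.sin q.2 / (2 * Real.cos q.2 ^ 2))) z)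
    (fun z => 0 + l * quad (curlForce h) (curlLeft A) (curlRight A) (fun _ => 0)
      (fun _ => 0) (fun _ => 0) z)

theorem explicitPencil_skew (l : ℝ) (z : Phase) (i j : Fin 4) :
    explicitPencil A h l z j i = -explicitPencil A h l z i j := by
  fin_cases i <;> fin_cases j <;> simp [explicitPencil, skewField]

end pencil

theorem hasDerivAt_inv_cos {y : ℝ} (hc : Real.cos y ≠ 0) :
    HasDerivAt (fun t => (Real.cos t)⁻¹) (Real.sin y / Real.cos y ^ 2) y := by
  refine ((Real.hasDerivAt_cos y).inv hc).congr_deriv ?_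
  rw [neg_neg]

theorem hasDerivAt_inv_cos_sq_mul_sin {y : ℝ} (hc : Real.cos y ≠ 0) (hs : Real.sin y ≠ 0) :
    HasDerivAt (fun t => -(Real.cos t ^ 2 * Real.sin t)⁻¹)
      ((Real.cos y ^ 2 - 2 * Real.sin y ^ 2) / (Real.cos y ^ 3 * Real.sin y ^ 2)) y := by
  have := ((((Real.hasDerivAt_cos y).pow 2).mul (Real.hasDerivAt_sin y)).inv
    (mul_ne_zero (pow_ne_zero 2 hc) hs)).neg
  refine this.congr_deriv ?_
  simp
  field_simp
  ring

theorem hasDerivAt_inv_two_mul_sin {y : ℝ} (hs : Real.sin y ≠ 0) :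
    HasDerivAt (fun t => -(2 * Real.sin t)⁻¹) (Real.cos y / (2 * Real.sin y ^ 2)) y := by
  have := (((Real.hasDerivAt_sin y).const_mul 2).inv (mul_ne_zero two_ne_zero hs)).neg
  refine this.congr_deriv ?_
  field_simp

theorem hasDerivAt_sin_div_two_mul_cos_sq {y : ℝ} (hc : Real.cos y ≠ 0) :
    HasDerivAt (fun t => -(Real.sin t / (2 * Real.cos t ^ 2)))
      (-((Real.cos y ^ 2 + 2 * Real.sin y ^ 2) / (2 * Real.cos y ^ 3))) y := by
  have := ((Real.hasDerivAt_sin y).div (((Real.hasDerivAt_cos y).pow 2).const_mul 2)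
    (mul_ne_zero two_ne_zero (pow_ne_zero 2 hc))).neg
  refine this.congr_deriv ?_
  simp
  field_simp

/-- The Schouten square of `P + l Q` for a skew-symmetric `Q` with components `qij`. Since `P` is
constant, only the derivatives of the `qij` enter. -/
theorem schouten_skewField (l : ℝ) (q01 q02 q03 q12 q13 q23 : Phase → ℝ) (z : Phase)
    (N : BivectorField) (hN : N = skewField (fun z => 0 + l * q01 z) (fun z => 1 + l * q02 z)
      (fun z => 0 + l * q03 z) (fun z => 0 + l * q12 z) (fun z => 1 + l * q13 z)
      (fun z => 0 + l * q23 z)) :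
    schouten N N z 0 1 2 =
      -2 * ((1 + l * q02 z) * (l * pderiv 0 q01 z) + (l * q12 z) * (l * pderiv 1 q01 z)
        + (-(l * q23 z)) * (l * pderiv 3 q01 z) + (-(l * q01 z)) * (l * pderiv 1 q12 z)
        + (-(1 + l * q02 z)) * (l * pderiv 2 q12 z) + (-(l * q03 z)) * (l * pderiv 3 q12 z)
        + (l * q01 z) * (-(l * pderiv 0 q02 z)) + (-(l * q12 z)) * (-(l * pderiv 2 q02 z))
        + (-(1 + l * q13 z)) * (-(l * pderiv 3 q02 z))) ∧
    schouten N N z 0 1 3 =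
      -2 * ((l * q03 z) * (l * pderiv 0 q01 z) + (1 + l * q13 z) * (l * pderiv 1 q01 z)
        + (l * q23 z) * (l * pderiv 2 q01 z) + (-(l * q01 z)) * (l * pderiv 1 q13 z)
        + (-(1 + l * q02 z)) * (l * pderiv 2 q13 z) + (-(l * q03 z)) * (l * pderiv 3 q13 z)
        + (l * q01 z) * (-(l * pderiv 0 q03 z)) + (-(l * q12 z)) * (-(l * pderiv 2 q03 z))
        + (-(1 + l * q13 z)) * (-(l * pderiv 3 q03 z))) ∧
    schouten N N z 0 2 3 =
      -2 * ((l * q03 z) * (l * pderiv 0 q02 z) + (1 + l * q13 z) * (l * pderiv 1 q02 z)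
        + (l * q23 z) * (l * pderiv 2 q02 z) + (-(l * q01 z)) * (l * pderiv 1 q23 z)
        + (-(1 + l * q02 z)) * (l * pderiv 2 q23 z) + (-(l * q03 z)) * (l * pderiv 3 q23 z)
        + (1 + l * q02 z) * (-(l * pderiv 0 q03 z)) + (l * q12 z) * (-(l * pderiv 1 q03 z))
        + (-(l * q23 z)) * (-(l * pderiv 3 q03 z))) ∧
    schouten N N z 1 2 3 =
      -2 * ((l * q03 z) * (l * pderiv 0 q12 z) + (1 + l * q13 z) * (l * pderiv 1 q12 z)
        + (l * q23 z) * (l * pderiv 2 q12 z) + (l * q01 z) * (l * pderiv 0 q23 z)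
        + (-(l * q12 z)) * (l * pderiv 2 q23 z) + (-(1 + l * q13 z)) * (l * pderiv 3 q23 z)
        + (1 + l * q02 z) * (-(l * pderiv 0 q13 z)) + (l * q12 z) * (-(l * pderiv 1 q13 z))
        + (-(l * q23 z)) * (-(l * pderiv 3 q13 z))) := by
  subst hN
  refine ⟨?_, ?_, ?_, ?_⟩ <;>
  simp only [schouten, Fin.sum_univ_four, skewField, Matrix.of_apply, Matrix.cons_val,
    pderiv_neg, pderiv_const_add_const_mul] <;> ring

section pencil

variable {A : ℝ × ℝ → Matrix (Fin 2) (Fin 2) ℝ} {h : ℝ × ℝ → Fin 2 → ℝ}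

/-- The independent components of the Schouten square, collected as polynomials in the momenta.
The part linear in `l` vanishes identically, and so does the part cubic in the momenta. -/
theorem schouten_explicitPencil {U : Set (ℝ × ℝ)} (hU : IsOpen U)
    (hA : ∀ i j, ContDiffOn ℝ ∞ (fun q => A q i j) U)
    (hh : ∀ i, ContDiffOn ℝ ∞ (fun q => h q i) U) {z : Phase} {q : ℝ × ℝ} (hzq : (z 0, z 1) = q)
    (hq : q ∈ U) (hc : Real.cos q.2 ≠ 0) (hs : Real.sin q.2 ≠ 0) (l : ℝ) :
    schouten (explicitPencil A h l) (explicitPencil A h l) z 0 1 2 =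
      -2 * l ^ 2 * ((dx (fun r => A r 0 0) q + dy (fun r => A r 0 1) q
        - A q 0 1 * Real.sin q.2 / Real.cos q.2) / Real.cos q.2 * z 2) ∧
    schouten (explicitPencil A h l) (explicitPencil A h l) z 0 1 3 =
      -2 * l ^ 2 * (((A q 1 1 - A q 0 0) / Real.sin q.2 + (curlLeft A q + dy (fun r => A r 1 1) q
          + dx (fun r => A r 1 0) q) / Real.cos q.2) * z 2
        + (curlRight A q / Real.cos q.2 - A q 1 0 * Real.sin q.2 / Real.cos q.2 ^ 2
          + A q 0 1 / (Real.cos q.2 ^ 2 * Real.sin q.2)) * z 3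
        + curlForce h q / Real.cos q.2) ∧
    schouten (explicitPencil A h l) (explicitPencil A h l) z 0 2 3 =
      -2 * l ^ 2 * ((dy (fun r => A r 0 0) q / (2 * Real.sin q.2)
          - dy (curlLeft A) q / Real.cos q.2
          - curlLeft A q / (Real.cos q.2 ^ 2 * Real.sin q.2)) * z 2 ^ 2
        + dy (fun r => A r 0 0) q * Real.sin q.2 / (2 * Real.cos q.2 ^ 2) * z 3 ^ 2
        + (dx (fun r => A r 0 0) q / (Real.cos q.2 ^ 2 * Real.sin q.2)
          - dy (curlRight A) q / Real.cos q.2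
          + A q 0 1 * (Real.cos q.2 ^ 2 - 2 * Real.sin q.2 ^ 2)
            / (Real.cos q.2 ^ 3 * Real.sin q.2 ^ 2)) * (z 2 * z 3)
        + (-dy (curlForce h) q / Real.cos q.2
          - curlForce h q / (Real.cos q.2 ^ 2 * Real.sin q.2)) * z 2
        + (dx (fun r => A r 0 0) q * A q 1 0 + dy (fun r => A r 0 0) q * A q 1 1
          + A q 0 0 * curlLeft A q + A q 1 0 * curlRight A q - A q 0 0 * dx (fun r => A r 1 0) q
          - A q 0 1 * dy (fun r => A r 1 0) q)) ∧
    schouten (explicitPencil A h l) (explicitPencil A h l) z 1 2 3 =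
      -2 * l ^ 2 * ((dy (fun r => A r 0 1) q / (2 * Real.sin q.2)
          + dx (curlLeft A) q / Real.cos q.2 + curlRight A q / (2 * Real.sin q.2)
          + A q 0 1 * Real.cos q.2 / (2 * Real.sin q.2 ^ 2)) * z 2 ^ 2
        + (dy (fun r => A r 0 1) q * Real.sin q.2 / (2 * Real.cos q.2 ^ 2)
          - curlRight A q * Real.sin q.2 / (2 * Real.cos q.2 ^ 2)
          - A q 0 1 * (Real.cos q.2 ^ 2 + 2 * Real.sin q.2 ^ 2) / (2 * Real.cos q.2 ^ 3)) * z 3 ^ 2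
        + (dx (fun r => A r 0 1) q / (Real.cos q.2 ^ 2 * Real.sin q.2)
          + dx (curlRight A) q / Real.cos q.2
          - curlLeft A q * Real.sin q.2 / Real.cos q.2 ^ 2) * (z 2 * z 3)
        + dx (curlForce h) q / Real.cos q.2 * z 2
        - curlForce h q * Real.sin q.2 / Real.cos q.2 ^ 2 * z 3
        + (A q 1 0 * dx (fun r => A r 0 1) q + A q 1 1 * dy (fun r => A r 0 1) q
          + A q 0 1 * curlLeft A q + A q 1 1 * curlRight A q - A q 0 0 * dx (fun r => A r 1 1) q
          - A q 0 1 * dy (fun r => A r 1 1) q)) := by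
  have hD : ∀ {F : ℝ × ℝ → ℝ}, ContDiffOn ℝ ∞ F U → DifferentiableAt ℝ F (z 0, z 1) := by
    intro F hF
    exact (hF.contDiffAt (hU.mem_nhds (hzq ▸ hq))).differentiableAt (by simp)
  have hR : ContDiffOn ℝ ∞ (curlLeft A) U :=
    (contDiffOn_dx hU (hA 1 0)).sub (contDiffOn_dy hU (hA 0 0))
  have hS : ContDiffOn ℝ ∞ (curlRight A) U :=
    (contDiffOn_dx hU (hA 1 1)).sub (contDiffOn_dy hU (hA 0 1))
  have hu : ContDiffOn ℝ ∞ (curlForce h) U :=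
    (contDiffOn_dx hU (hh 1)).sub (contDiffOn_dy hU (hh 0))
  have h0 : DifferentiableAt ℝ (fun _ : ℝ × ℝ => (0 : ℝ)) (z 0, z 1) :=
    differentiableAt_const 0
  subst hzq
  have d1 := hasDerivAt_inv_cos hc
  have d2 := hasDerivAt_inv_cos_sq_mul_sin hc hs
  have d3 := hasDerivAt_inv_two_mul_sin hs
  have d4 := hasDerivAt_sin_div_two_mul_cos_sq hc
  obtain ⟨p010, p011, p012, p013⟩ := pderiv_quad h0 (differentiableAt_comp_snd d1) h0 h0 h0 h0
  obtain ⟨p020, p021, p022, p023⟩ := pderiv_quad (hD (hA 0 0).neg) h0 h0 h0 h0 h0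
  obtain ⟨p030, p031, p032, p033⟩ := pderiv_quad (hD (hA 1 0).neg) h0 h0 h0
    (differentiableAt_comp_snd d2) h0
  obtain ⟨p120, p121, p122, p123⟩ := pderiv_quad (hD (hA 0 1).neg) h0 h0 h0 h0 h0
  obtain ⟨p130, p131, p132, p133⟩ := pderiv_quad (hD (hA 1 1).neg) h0 h0
    (differentiableAt_comp_snd d3) h0 (differentiableAt_comp_snd d4)
  obtain ⟨p230, p231, p232, p233⟩ := pderiv_quad (hD hu) (hD hR) (hD hS) h0 h0 h0
  obtain ⟨e1, e2, e3, e4⟩ := schouten_skewField l _ _ _ _ _ _ z (explicitPencil A h l) rfl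
  have hsc := Real.sin_sq_add_cos_sq (z 1)
  have x1 := dx_comp_snd (q := (z 0, z 1)) d1
  have y1 := dy_comp_snd (q := (z 0, z 1)) d1
  have x2 := dx_comp_snd (q := (z 0, z 1)) d2
  have y2 := dy_comp_snd (q := (z 0, z 1)) d2
  have x3 := dx_comp_snd (q := (z 0, z 1)) d3
  have y3 := dy_comp_snd (q := (z 0, z 1)) d3
  have x4 := dx_comp_snd (q := (z 0, z 1)) d4
  have y4 := dy_comp_snd (q := (z 0, z 1)) d4
  have nx := fun i j => dx_neg (fun r => A r i j) (z 0, z 1)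
  have ny := fun i j => dy_neg (fun r => A r i j) (z 0, z 1)
  have hRd : curlLeft A (z 0, z 1)
    = dx (fun r => A r 1 0) (z 0, z 1) - dy (fun r => A r 0 0) (z 0, z 1) := rfl
  have hSd : curlRight A (z 0, z 1)
    = dx (fun r => A r 1 1) (z 0, z 1) - dy (fun r => A r 0 1) (z 0, z 1) := rfl
  simp only [p010, p011, p012, p013, p020, p021, p022, p023, p030, p031, p032, p033, p120, p121,
    p122, p123, p130, p131, p132, p133, p230, p231, p232, p233,
    quad, dx_zero, dy_zero, nx, ny, x1, y1, x2, y2, x3, y3, x4, y4,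
    zero_mul, add_zero, zero_add, mul_zero] at e1 e2 e3 e4
  simp only at hc hs ⊢
  refine ⟨?_, ?_, ?_, ?_⟩
  · rw [e1]
    field_simp
    ring
  · rw [e2]
    linear_combination (norm := (field_simp; ring))
      -2 * (l * z 2 / (Real.cos (z 1) ^ 2 * Real.sin (z 1))
        + l ^ 2 * (-z 2 ^ 3 / (2 * Real.sin (z 1) ^ 2 * Real.cos (z 1) ^ 2)
          + z 2 * z 3 ^ 2 / (2 * Real.cos (z 1) ^ 4)
          - A (z 0, z 1) 1 1 * z 2 / (Real.cos (z 1) ^ 2 * Real.sin (z 1)))) * hsc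
  · rw [e3]
    linear_combination (norm := (field_simp; ring)) 2 * l * hRd
  · rw [e4]
    linear_combination (norm := (field_simp; ring)) 2 * l * hSd

end pencil

/-! ### Identification of the deformed pencil with its coordinate expression -/

theorem hasDerivAt_log_tan_half {y : ℝ} (hs : 0 < Real.sin y) :
    HasDerivAt (fun t => Real.log ((1 - Real.cos t) / Real.sin t)) (1 / Real.sin y) y := by
  have hsc := Real.sin_sq_add_cos_sq y
  have h1 : 0 < 1 - Real.cos y := by nlinarith [Real.cos_le_one y, sq_pos_of_pos hs]
  have := (((Real.hasDerivAt_cos y).const_sub 1).div (Real.hasDerivAt_sin y) hs.ne').log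
    (div_pos h1 hs).ne'
  refine this.congr_deriv ?_
  simp only [neg_neg, Pi.div_apply]
  field_simp
  linear_combination hsc

theorem kineticField_zero : (fun w => kineticField w 0) =
    quad (fun _ => 0) (fun _ => 0) (fun _ => 0) (fun _ => 0)
      (fun q => (Real.cos q.2)⁻¹ + Real.log ((1 - Real.cos q.2) / Real.sin q.2)) (fun _ => 0) := by
  funext w
  simp [kineticField, quad]
  ring

theorem kineticField_one : (fun w => kineticField w 1) =
    quad (fun _ => 0) (fun _ => 0) (fun _ => 0)
      (fun q => 1 / 2 * Real.log ((1 - Real.cos q.2) / Real.sin q.2)) (fun _ => 0)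
      (fun q => 1 / 2 * (Real.cos q.2)⁻¹) := by
  funext w
  simp only [kineticField, quad, Matrix.cons_val]
  ring

theorem kineticField_two : (fun w => kineticField w 2) = fun _ => 0 := by
  funext w
  simp [kineticField]

theorem kineticField_three : (fun w => kineticField w 3) = fun _ => 0 := by
  funext w
  simp [kineticField]

section potential

variable (A : ℝ × ℝ → Matrix (Fin 2) (Fin 2) ℝ) (h : ℝ × ℝ → Fin 2 → ℝ)

theorem potentialField_zero : (fun w => potentialField A h w 0) = fun _ => 0 := by
  funext w
  simp [potentialField]

theorem potentialField_one : (fun w => potentialField A h w 1) = fun _ => 0 := by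
  funext w
  simp [potentialField]

theorem potentialField_two : (fun w => potentialField A h w 2) =
    quad (fun q => h q 0) (fun q => A q 0 0) (fun q => A q 0 1) (fun _ => 0) (fun _ => 0)
      (fun _ => 0) := by
  funext w
  simp [potentialField, quad]
  ring

theorem potentialField_three : (fun w => potentialField A h w 3) =
    quad (fun q => h q 1) (fun q => A q 1 0) (fun q => A q 1 1) (fun _ => 0) (fun _ => 0)
      (fun _ => 0) := by
  funext w
  simp [potentialField, quad]
  ring

end potential

/-- The `θ`-derivative of the logarithm in `Z` is `1 / sin θ`, while the logarithm itself drops out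
of `{φ, θ}`. -/
theorem deformedPencil_eq_explicitPencil {A : ℝ × ℝ → Matrix (Fin 2) (Fin 2) ℝ}
    {h : ℝ × ℝ → Fin 2 → ℝ} {z : Phase}
    (hA : ∀ i j, DifferentiableAt ℝ (fun q => A q i j) (z 0, z 1))
    (hh : ∀ i, DifferentiableAt ℝ (fun q => h q i) (z 0, z 1))
    (hc : Real.cos (z 1) ≠ 0) (hs : 0 < Real.sin (z 1)) (l : ℝ) :
    deformedPencil (potentialField A h) l z = explicitPencil A h l z := by
  have h0 : DifferentiableAt ℝ (fun _ : ℝ × ℝ => (0 : ℝ)) (z 0, z 1) :=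
    differentiableAt_const 0
  have d1 := hasDerivAt_inv_cos hc
  have d2 := hasDerivAt_log_tan_half hs
  have hsc := Real.sin_sq_add_cos_sq (z 1)
  have d3 := (d1.add d2).congr_deriv (g' := (Real.cos (z 1) ^ 2 * Real.sin (z 1))⁻¹)
    (by field_simp; exact hsc)
  have d4 := d2.const_mul (1 / 2)
  have d5 := d1.const_mul (1 / 2)
  obtain ⟨p00, p01, p02, p03⟩ := pderiv_quad h0 h0 h0 h0 (differentiableAt_comp_snd d3) h0
  obtain ⟨p10, p11, p12, p13⟩ := pderiv_quad h0 h0 h0 (differentiableAt_comp_snd d4) h0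
    (differentiableAt_comp_snd d5)
  obtain ⟨p20, p21, p22, p23⟩ := pderiv_quad (hh 0) (hA 0 0) (hA 0 1) h0 h0 h0
  obtain ⟨p30, p31, p32, p33⟩ := pderiv_quad (hh 1) (hA 1 0) (hA 1 1) h0 h0 h0
  have x3 := dx_comp_snd (q := (z 0, z 1)) d3
  have y3 := dy_comp_snd (q := (z 0, z 1)) d3
  have x4 := dx_comp_snd (q := (z 0, z 1)) d4
  have y4 := dy_comp_snd (q := (z 0, z 1)) d4
  have x5 := dx_comp_snd (q := (z 0, z 1)) d5
  have y5 := dy_comp_snd (q := (z 0, z 1)) d5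
  simp only [Pi.add_apply] at *
  ext i j
  fin_cases i <;> fin_cases j <;>
  simp only [deformedPencil, kineticPencil, lieDeriv, Fin.sum_univ_four, explicitPencil,
    skewField, canonicalBivector, Matrix.add_apply, Matrix.smul_apply, Matrix.of_apply,
    Matrix.cons_val, pderiv_const, kineticField_zero, kineticField_one, kineticField_two,
    kineticField_three, potentialField_zero, potentialField_one, potentialField_two,
    potentialField_three, smul_eq_mul, Fin.zero_eta, Fin.mk_one, Fin.reduceFinMk,
    p00, p01, p02, p03, p10, p11, p12, p13, p20, p21, p22, p23, p30, p31, p32, p33,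
    quad, dx_zero, dy_zero, x3, y3, x4, y4, x5, y5,
    curlLeft, curlRight, curlForce] <;>
  ring

/-! ### The normal form satisfies the Poisson condition -/

theorem dx_eq_of_eqOn {F G : ℝ × ℝ → ℝ} {V : Set (ℝ × ℝ)} (hV : IsOpen V) (hFG : Set.EqOn F G V)
    {x y v : ℝ} (hq : (x, y) ∈ V) (hF : DifferentiableAt ℝ F (x, y))
    (hG : HasDerivAt (fun t => G (t, y)) v x) : dx F (x, y) = v := by
  refine dx_eq hF (hG.congr_of_eventuallyEq ?_)
  have hc : ContinuousAt (fun t : ℝ => (t, y)) x := by fun_prop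
  exact (hc.eventually_mem (hV.mem_nhds hq)).mono fun t ht => hFG ht

theorem dy_eq_of_eqOn {F G : ℝ × ℝ → ℝ} {V : Set (ℝ × ℝ)} (hV : IsOpen V) (hFG : Set.EqOn F G V)
    {x y v : ℝ} (hq : (x, y) ∈ V) (hF : DifferentiableAt ℝ F (x, y))
    (hG : HasDerivAt (fun t => G (x, t)) v y) : dy F (x, y) = v := by
  refine dy_eq hF (hG.congr_of_eventuallyEq ?_)
  have hc : ContinuousAt (fun t : ℝ => (x, t)) y := by fun_prop
  exact (hc.eventually_mem (hV.mem_nhds hq)).mono fun t ht => hFG ht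

/-- The common shape of both families. It is meant for `w₁ = w'` and `E₁ = E'`; the derivatives are
separate arguments so that closed formulas can be supplied for them. -/
def normalForm (κ : ℝ) (w w₁ E E₁ : ℝ → ℝ) (q : ℝ × ℝ) : Matrix (Fin 2) (Fin 2) ℝ :=
  !![κ + w q.1, -(w₁ q.1 * (Real.sin q.2 / Real.cos q.2) + E₁ q.1 * (Real.cos q.2)⁻¹);
     -(w₁ q.1 * (Real.cos q.2 / Real.sin q.2)), κ - w q.1 + E q.1 * (Real.sin q.2)⁻¹]

/-- A normal form whose functions satisfy `w'' = -w` and `w' E'' - 3 w E' - 2 w' E = 0` solves all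
the coefficient equations. -/
theorem schouten_explicitPencil_eq_zero {A : ℝ × ℝ → Matrix (Fin 2) (Fin 2) ℝ}
    {h : ℝ × ℝ → Fin 2 → ℝ} {V : Set (ℝ × ℝ)} (hV : IsOpen V)
    (hA : ∀ i j, ContDiffOn ℝ ∞ (fun q => A q i j) V)
    (hh : ∀ i, ContDiffOn ℝ ∞ (fun q => h q i) V)
    (hc : ∀ q ∈ V, Real.cos q.2 ≠ 0) (hs : ∀ q ∈ V, Real.sin q.2 ≠ 0)
    (hu : ∀ q ∈ V, curlForce h q = 0)
    {κ : ℝ} {w w₁ E E₁ E₂ : ℝ → ℝ} (hAV : ∀ q ∈ V, A q = normalForm κ w w₁ E E₁ q)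
    (hw : ∀ q ∈ V, HasDerivAt w (w₁ q.1) q.1) (hw₁ : ∀ q ∈ V, HasDerivAt w₁ (-w q.1) q.1)
    (hE : ∀ q ∈ V, HasDerivAt E (E₁ q.1) q.1) (hE₁ : ∀ q ∈ V, HasDerivAt E₁ (E₂ q.1) q.1)
    (hode : ∀ q ∈ V, w₁ q.1 * E₂ q.1 - 3 * w q.1 * E₁ q.1 - 2 * w₁ q.1 * E q.1 = 0)
    {z : Phase} (hz : (z 0, z 1) ∈ V) (l : ℝ) (i j k : Fin 4) :
    schouten (explicitPencil A h l) (explicitPencil A h l) z i j k = 0 := by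
  have hD : ∀ {F : ℝ × ℝ → ℝ}, ContDiffOn ℝ ∞ F V → ∀ {q}, q ∈ V → DifferentiableAt ℝ F q :=
    fun hF q hq => (hF.contDiffAt (hV.mem_nhds hq)).differentiableAt (by simp)
  have hsc : ∀ y : ℝ, Real.sin y ^ 2 + Real.cos y ^ 2 = 1 := Real.sin_sq_add_cos_sq
  -- derivatives of the functions of `θ` that enter the normal form
  have dc : ∀ q ∈ V, HasDerivAt (fun t => (Real.cos t)⁻¹)
      (Real.sin q.2 / Real.cos q.2 ^ 2) q.2 := fun q hq => hasDerivAt_inv_cos (hc q hq)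
  have ds : ∀ q ∈ V, HasDerivAt (fun t => (Real.sin t)⁻¹)
      (-Real.cos q.2 / Real.sin q.2 ^ 2) q.2 := fun q hq =>
    (Real.hasDerivAt_sin q.2).inv (hs q hq)
  have dt : ∀ q ∈ V, HasDerivAt (fun t => Real.sin t / Real.cos t)
      ((Real.cos q.2 ^ 2)⁻¹) q.2 := fun q hq =>
    ((Real.hasDerivAt_sin q.2).div (Real.hasDerivAt_cos q.2) (hc q hq)).congr_deriv (by
      have := hc q hq
      field_simp
      linear_combination hsc q.2)
  have dct : ∀ q ∈ V, HasDerivAt (fun t => Real.cos t / Real.sin t)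
      (-(Real.sin q.2 ^ 2)⁻¹) q.2 := fun q hq =>
    ((Real.hasDerivAt_cos q.2).div (Real.hasDerivAt_sin q.2) (hs q hq)).congr_deriv (by
      have := hs q hq
      field_simp
      linear_combination -hsc q.2)
  have dcc : ∀ q ∈ V, HasDerivAt (fun t => (Real.cos t ^ 2)⁻¹)
      (2 * Real.sin q.2 / Real.cos q.2 ^ 3) q.2 := fun q hq =>
    (((Real.hasDerivAt_cos q.2).pow 2).inv (pow_ne_zero 2 (hc q hq))).congr_deriv (by
      have := hc q hq
      simp
      field_simp)
  have dsc : ∀ q ∈ V, HasDerivAt (fun t => Real.sin t / Real.cos t ^ 2)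
      ((Real.cos q.2 ^ 2 + 2 * Real.sin q.2 ^ 2) / Real.cos q.2 ^ 3) q.2 := fun q hq =>
    ((Real.hasDerivAt_sin q.2).div ((Real.hasDerivAt_cos q.2).pow 2)
      (pow_ne_zero 2 (hc q hq))).congr_deriv (by
      have := hc q hq
      simp
      field_simp)
  -- first derivatives of the entries
  have ea : Set.EqOn (fun q => A q 0 0) (fun q => κ + w q.1) V := fun q hq => by
    simp [hAV q hq, normalForm]
  have eb : Set.EqOn (fun q => A q 0 1) (fun q => -(w₁ q.1 * (Real.sin q.2 / Real.cos q.2)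
      + E₁ q.1 * (Real.cos q.2)⁻¹)) V := fun q hq => by
    simp [hAV q hq, normalForm]
  have ed : Set.EqOn (fun q => A q 1 0) (fun q => -(w₁ q.1 * (Real.cos q.2 / Real.sin q.2))) V :=
    fun q hq => by simp [hAV q hq, normalForm]
  have ee : Set.EqOn (fun q => A q 1 1) (fun q => κ - w q.1 + E q.1 * (Real.sin q.2)⁻¹) V :=
    fun q hq => by simp [hAV q hq, normalForm]
  have ax : ∀ q ∈ V, dx (fun r => A r 0 0) q = w₁ q.1 := fun q hq =>
    dx_eq_of_eqOn hV ea hq (hD (hA 0 0) hq) ((hw q hq).const_add κ)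
  have ay : ∀ q ∈ V, dy (fun r => A r 0 0) q = 0 := fun q hq =>
    dy_eq_of_eqOn hV ea hq (hD (hA 0 0) hq) (hasDerivAt_const q.2 (κ + w q.1))
  have bx : ∀ q ∈ V, dx (fun r => A r 0 1) q
      = -(-w q.1 * (Real.sin q.2 / Real.cos q.2) + E₂ q.1 * (Real.cos q.2)⁻¹) := fun q hq =>
    dx_eq_of_eqOn hV eb hq (hD (hA 0 1) hq)
      (((hw₁ q hq).mul_const (Real.sin q.2 / Real.cos q.2)).fun_add
        ((hE₁ q hq).mul_const (Real.cos q.2)⁻¹)).fun_neg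
  have bY : ∀ q ∈ V, dy (fun r => A r 0 1) q
      = -(w₁ q.1 * (Real.cos q.2 ^ 2)⁻¹ + E₁ q.1 * (Real.sin q.2 / Real.cos q.2 ^ 2)) := fun q hq =>
    dy_eq_of_eqOn hV eb hq (hD (hA 0 1) hq)
      (((dt q hq).const_mul (w₁ q.1)).fun_add ((dc q hq).const_mul (E₁ q.1))).fun_neg
  have dX : ∀ q ∈ V, dx (fun r => A r 1 0) q = -(-w q.1 * (Real.cos q.2 / Real.sin q.2)) :=
    fun q hq => dx_eq_of_eqOn hV ed hq (hD (hA 1 0) hq)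
      ((hw₁ q hq).mul_const (Real.cos q.2 / Real.sin q.2)).fun_neg
  have dY : ∀ q ∈ V, dy (fun r => A r 1 0) q = -(w₁ q.1 * -(Real.sin q.2 ^ 2)⁻¹) :=
    fun q hq => dy_eq_of_eqOn hV ed hq (hD (hA 1 0) hq) ((dct q hq).const_mul (w₁ q.1)).fun_neg
  have ex : ∀ q ∈ V, dx (fun r => A r 1 1) q = -w₁ q.1 + E₁ q.1 * (Real.sin q.2)⁻¹ :=
    fun q hq => dx_eq_of_eqOn hV ee hq (hD (hA 1 1) hq)
      (((hw q hq).const_sub κ).fun_add ((hE q hq).mul_const (Real.sin q.2)⁻¹))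
  have ey : ∀ q ∈ V, dy (fun r => A r 1 1) q = E q.1 * (-Real.cos q.2 / Real.sin q.2 ^ 2) :=
    fun q hq => dy_eq_of_eqOn hV ee hq (hD (hA 1 1) hq)
      (((ds q hq).const_mul (E q.1)).const_add (κ - w q.1))
  -- second derivatives
  have eR : Set.EqOn (curlLeft A) (fun q => w q.1 * (Real.cos q.2 / Real.sin q.2)) V :=
    fun q hq => by simp only [curlLeft, dX q hq, ay q hq]; ring
  have eS : Set.EqOn (curlRight A) (fun q => -w₁ q.1 + E₁ q.1 * (Real.sin q.2)⁻¹
      + (w₁ q.1 * (Real.cos q.2 ^ 2)⁻¹ + E₁ q.1 * (Real.sin q.2 / Real.cos q.2 ^ 2))) V :=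
    fun q hq => by simp only [curlRight, ex q hq, bY q hq]; ring
  have hR : ContDiffOn ℝ ∞ (curlLeft A) V :=
    (contDiffOn_dx hV (hA 1 0)).sub (contDiffOn_dy hV (hA 0 0))
  have hS : ContDiffOn ℝ ∞ (curlRight A) V :=
    (contDiffOn_dx hV (hA 1 1)).sub (contDiffOn_dy hV (hA 0 1))
  have hu' : ContDiffOn ℝ ∞ (curlForce h) V :=
    (contDiffOn_dx hV (hh 1)).sub (contDiffOn_dy hV (hh 0))
  obtain ⟨q, hzq⟩ : ∃ q, (z 0, z 1) = q := ⟨_, rfl⟩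
  have hq : q ∈ V := hzq ▸ hz
  have Rx := dx_eq_of_eqOn hV eR hq (hD hR hq) ((hw q hq).mul_const (Real.cos q.2 / Real.sin q.2))
  have Ry := dy_eq_of_eqOn hV eR hq (hD hR hq) ((dct q hq).const_mul (w q.1))
  have Sx := dx_eq_of_eqOn hV eS hq (hD hS hq)
    (((hw₁ q hq).fun_neg.fun_add ((hE₁ q hq).mul_const (Real.sin q.2)⁻¹)).fun_add
      (((hw₁ q hq).mul_const (Real.cos q.2 ^ 2)⁻¹).fun_add
        ((hE₁ q hq).mul_const (Real.sin q.2 / Real.cos q.2 ^ 2))))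
  have Sy := dy_eq_of_eqOn hV eS hq (hD hS hq)
    ((((ds q hq).const_mul (E₁ q.1)).const_add (-w₁ q.1)).fun_add
      (((dcc q hq).const_mul (w₁ q.1)).fun_add ((dsc q hq).const_mul (E₁ q.1))))
  have ux : dx (curlForce h) q = 0 := dx_eq_of_eqOn hV (G := fun _ => 0) hu hq (hD hu' hq)
    (hasDerivAt_const _ _)
  have uy : dy (curlForce h) q = 0 := dy_eq_of_eqOn hV (G := fun _ => 0) hu hq (hD hu' hq)
    (hasDerivAt_const _ _)
  have hc' := hc q hq
  have hs' := hs q hq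
  have ho := hode q hq
  have hsc' := hsc q.2
  obtain ⟨f₁, f₂, f₃, f₄⟩ := schouten_explicitPencil hV hA hh hzq hq hc' hs' l
  simp only [Prod.mk.eta] at Rx Ry Sx Sy
  simp only [ax q hq, ay q hq, bx q hq, bY q hq, dX q hq, dY q hq, ex q hq, ey q hq, Rx, Ry, Sx, Sy,
    ux, uy, hu q hq, eR hq, eS hq, show A q 0 0 = _ from ea hq, show A q 0 1 = _ from eb hq,
    show A q 1 0 = _ from ed hq, show A q 1 1 = _ from ee hq] at f₁ f₂ f₃ f₄
  generalize Real.cos q.2 = c at *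
  generalize Real.sin q.2 = s at *
  have hs2 : s ^ 2 = 1 - c ^ 2 := by linear_combination hsc'
  refine schouten_eq_zero_of_skew (explicitPencil_skew A h l) ?_ ?_ ?_ ?_ i j k
  · rw [f₁]
    clear * - hc' hs' ho hsc'
    field_simp
    grind
  · rw [f₂]
    clear * - hc' hs' ho hsc'
    field_simp
    grind
  · rw [f₃]
    clear * - hc' hs' ho hsc'
    field_simp
    grind
  · rw [f₄]
    clear * - hc' hs' ho hsc'
    field_simp
    grind

/-! ### The differential equations on the coefficients -/

/-- The differential equations on the entries of `A` (and on `h`) at `q` from which the normal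
form is obtained; they follow from the vanishing of the Schouten square. -/
structure PencilEquations (A : ℝ × ℝ → Matrix (Fin 2) (Fin 2) ℝ) (h : ℝ × ℝ → Fin 2 → ℝ)
    (q : ℝ × ℝ) : Prop where
  curl : curlForce h q = 0
  a_theta : dy (fun r => A r 0 0) q = 0
  d_eq : A q 1 0 * Real.sin q.2 = -(dx (fun r => A r 0 0) q * Real.cos q.2)
  e_phi : dx (fun r => A r 1 1) q * Real.sin q.2
    = -2 * dx (fun r => A r 0 0) q * Real.sin q.2 - A q 0 1 * Real.cos q.2
  d_phi_phi : dx (fun r => A r 1 1) q * Real.sin q.2 * Real.cos q.2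
    + 2 * dx (curlLeft A) q * Real.sin q.2 ^ 2 + A q 0 1 * Real.cos q.2 ^ 2 = 0
  e_theta : (A q 1 1 - A q 0 0) * Real.cos q.2
    + (2 * dx (fun r => A r 1 0) q + dy (fun r => A r 1 1) q) * Real.sin q.2 = 0
  compat : A q 1 0 * dx (fun r => A r 0 1) q + (A q 1 1 - A q 0 0) * dx (fun r => A r 1 1) q
    + A q 0 1 * dx (fun r => A r 1 0) q - A q 0 1 * dy (fun r => A r 1 1) q = 0

theorem linear_coeff {α : ℝ} (H : ∀ p : ℝ, 0 = -2 * 1 ^ 2 * (α * p)) : α = 0 := by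
  linarith [H 1]

theorem affine_coeff {α β ζ : ℝ} (H : ∀ p r : ℝ, 0 = -2 * 1 ^ 2 * (α * p + β * r + ζ)) :
    α = 0 ∧ β = 0 ∧ ζ = 0 := by
  refine ⟨?_, ?_, ?_⟩ <;> linarith [H 0 0, H 1 0, H 0 1]

theorem quadratic_coeff_add {α β γ δ ζ : ℝ} (H : ∀ p r : ℝ,
    0 = -2 * 1 ^ 2 * (α * p ^ 2 + β * r ^ 2 + γ * (p * r) + δ * p + ζ)) :
    α = 0 ∧ β = 0 ∧ ζ = 0 := by
  refine ⟨?_, ?_, ?_⟩ <;> linarith [H 0 0, H 1 0, H (-1) 0, H 0 1]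

theorem quadratic_coeff_sub {α β γ δ ε ζ : ℝ} (H : ∀ p r : ℝ,
    0 = -2 * 1 ^ 2 * (α * p ^ 2 + β * r ^ 2 + γ * (p * r) + δ * p - ε * r + ζ)) :
    α = 0 ∧ β = 0 ∧ ζ = 0 := by
  refine ⟨?_, ?_, ?_⟩ <;> linarith [H 0 0, H 1 0, H (-1) 0, H 0 1, H 0 (-1)]

/-- The algebra that turns the vanishing coefficients of the Schouten square into the fields of
`PencilEquations`. -/
theorem entry_equations {a b d e ax bx dX ex bY eY Rx s c : ℝ} (hs : s ≠ 0) (hc : c ≠ 0)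
    (hsc : s ^ 2 + c ^ 2 = 1)
    (m₁ : (ax + bY - b * s / c) / c = 0)
    (m₃ : (e - a) / s + (dX - 0 + eY + dX) / c = 0)
    (m₄ : (ex - bY) / c - d * s / c ^ 2 + b / (c ^ 2 * s) = 0)
    (m₇ : bY / (2 * s) + Rx / c + (ex - bY) / (2 * s) + b * c / (2 * s ^ 2) = 0)
    (m₉ : bY * s / (2 * c ^ 2) - (ex - bY) * s / (2 * c ^ 2)
      - b * (c ^ 2 + 2 * s ^ 2) / (2 * c ^ 3) = 0)
    (m₁₀ : d * bx + e * bY + b * (dX - 0) + e * (ex - bY) - a * ex - b * eY = 0) :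
    d * s = -(ax * c) ∧ ex * s = -2 * ax * s - b * c ∧
      ex * s * c + 2 * Rx * s ^ 2 + b * c ^ 2 = 0 ∧ (e - a) * c + (2 * dX + eY) * s = 0 ∧
      d * bx + (e - a) * ex + b * dX - b * eY = 0 := by
  have n₁ : c * (ax + bY) = b * s := by
    have : (ax + bY) - b * s / c = 0 := by simpa only [div_eq_zero_iff, hc, or_false] using m₁
    field_simp at this
    linarith
  have n₃ : (e - a) * c + (2 * dX + eY) * s = 0 := by
    field_simp at m₃
    linarith
  have n₄ : (ex - bY) * c * s + b - d * s ^ 2 = 0 := by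
    have : ((ex - bY) / c - d * s / c ^ 2 + b / (c ^ 2 * s)) * (c ^ 2 * s) = 0 := by
      rw [m₄, zero_mul]
    field_simp at this
    linarith
  have n₇ : ex * s * c + 2 * Rx * s ^ 2 + b * c ^ 2 = 0 := by
    have : (bY / (2 * s) + Rx / c + (ex - bY) / (2 * s) + b * c / (2 * s ^ 2))
      * (2 * s ^ 2 * c) = 0 := by rw [m₇, zero_mul]
    field_simp at this
    linarith
  have n₉ : bY * s * c - (ex - bY) * s * c - b * (c ^ 2 + 2 * s ^ 2) = 0 := by
    have : (bY * s / (2 * c ^ 2) - (ex - bY) * s / (2 * c ^ 2)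
      - b * (c ^ 2 + 2 * s ^ 2) / (2 * c ^ 3)) * (2 * c ^ 3) = 0 := by rw [m₉, zero_mul]
    field_simp at this
    linarith
  have n : d * s = -(ax * c) := by
    refine mul_left_cancel₀ hs ?_
    linear_combination s * n₁ - n₄ - n₉ - b * hsc
  refine ⟨n, ?_, n₇, n₃, ?_⟩
  · refine mul_left_cancel₀ hc ?_
    linear_combination n₄ + s * n₁ + s * n + b * hsc
  · linear_combination m₁₀

theorem pencilEquations_of_schouten {A : ℝ × ℝ → Matrix (Fin 2) (Fin 2) ℝ}
    {h : ℝ × ℝ → Fin 2 → ℝ} {U : Set (ℝ × ℝ)} (hU : IsOpen U)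
    (hA : ∀ i j, ContDiffOn ℝ ∞ (fun q => A q i j) U)
    (hh : ∀ i, ContDiffOn ℝ ∞ (fun q => h q i) U) {q : ℝ × ℝ}
    (hq : q ∈ U) (hc : Real.cos q.2 ≠ 0) (hs : Real.sin q.2 ≠ 0)
    (hJ : ∀ z : Phase, (z 0, z 1) ∈ U → ∀ i j k,
      schouten (explicitPencil A h 1) (explicitPencil A h 1) z i j k = 0) :
    PencilEquations A h q := by
  have hsc := Real.sin_sq_add_cos_sq q.2
  -- the components are polynomials in the momenta, so their coefficients vanish
  have key := fun p r : ℝ => schouten_explicitPencil hU hA hh (z := ![q.1, q.2, p, r]) (q := q) rfl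
    hq hc hs 1
  have hz : ∀ p r : ℝ, ((![q.1, q.2, p, r] : Phase) 0, (![q.1, q.2, p, r] : Phase) 1) ∈ U :=
    fun _ _ => hq
  simp only [hJ _ (hz _ _), Matrix.cons_val] at key
  have m₁ := linear_coeff fun p => (key p 0).1
  obtain ⟨m₃, m₄, hu⟩ := affine_coeff fun p r => (key p r).2.1
  obtain ⟨-, m₆, -⟩ := quadratic_coeff_add fun p r => (key p r).2.2.1
  obtain ⟨m₇, m₉, m₁₀⟩ := quadratic_coeff_sub fun p r => (key p r).2.2.2
  clear key hz hJ hA hh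
  have hRd : curlLeft A q
    = dx (fun r => A r 1 0) q - dy (fun r => A r 0 0) q := rfl
  have hSd : curlRight A q
    = dx (fun r => A r 1 1) q - dy (fun r => A r 0 1) q := rfl
  replace hu : curlForce h q = 0 := by simpa [hc] using hu
  have hay : dy (fun r => A r 0 0) q = 0 := by simpa [hc, hs] using m₆
  clear m₆
  rw [hRd, hay] at m₃
  rw [hSd] at m₄ m₇ m₉
  rw [hRd, hSd, hay] at m₁₀
  obtain ⟨n₁, n₂, n₃, n₄, n₅⟩ := entry_equations hs hc hsc m₁ m₃ m₄ m₇ m₉ m₁₀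
  exact ⟨hu, hay, n₁, n₂, n₃, n₄, n₅⟩

/-! ### Integration of the equations to the normal form -/

theorem eq_of_hasDerivAt_zero {J : Set ℝ} (hJo : IsOpen J) (hJc : J.OrdConnected) {f : ℝ → ℝ}
    (hf : ∀ y ∈ J, HasDerivAt f 0 y) {x y : ℝ} (hx : x ∈ J) (hy : y ∈ J) : f x = f y :=
  hJo.is_const_of_deriv_eq_zero hJc.isPreconnected
    (fun t ht => (hf t ht).differentiableAt.differentiableWithinAt)
    (fun t ht => (hf t ht).deriv) hx hy

theorem hasDerivAt_of_contDiffOn {I : Set ℝ} (hIo : IsOpen I) {f : ℝ → ℝ}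
    (hf : ContDiffOn ℝ ∞ f I) {x : ℝ} (hx : x ∈ I) : HasDerivAt f (deriv f x) x :=
  ((hf.contDiffAt (hIo.mem_nhds hx)).differentiableAt (by simp)).hasDerivAt

theorem contDiffOn_deriv {I : Set ℝ} (hIo : IsOpen I) {f : ℝ → ℝ}
    (hf : ContDiffOn ℝ ∞ f I) : ContDiffOn ℝ ∞ (deriv f) I :=
  hf.deriv_of_isOpen hIo (by simp)

/-- The equations are integrated first along `θ`, which leaves the functions `w` and `E` of `φ`;
evaluated at one fixed `y₀`, the equations that remain are then ordinary ones for `w` and `E`. -/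
theorem exists_normalForm {I J : Set ℝ} (hIo : IsOpen I) (hIc : I.OrdConnected)
    (hIn : I.Nonempty) (hJo : IsOpen J) (hJc : J.OrdConnected) (hJn : J.Nonempty)
    (hc : ∀ y ∈ J, Real.cos y ≠ 0) (hs : ∀ y ∈ J, Real.sin y ≠ 0)
    {A : ℝ × ℝ → Matrix (Fin 2) (Fin 2) ℝ} {h : ℝ × ℝ → Fin 2 → ℝ}
    (hA : ∀ i j, ContDiffOn ℝ ∞ (fun q => A q i j) (I ×ˢ J))
    (hP : ∀ q ∈ I ×ˢ J, PencilEquations A h q) :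
    ∃ (κ : ℝ) (w E : ℝ → ℝ), ContDiffOn ℝ ∞ w I ∧ ContDiffOn ℝ ∞ E I ∧
      (∀ x ∈ I, HasDerivAt (deriv w) (-w x) x) ∧
      (∀ x ∈ I, deriv w x * deriv (deriv E) x - 3 * w x * deriv E x - 2 * deriv w x * E x = 0) ∧
      ∀ q ∈ I ×ˢ J, A q = normalForm κ w (deriv w) E (deriv E) q := by
  obtain ⟨x₀, hx₀⟩ := hIn
  obtain ⟨y₀, hy₀⟩ := hJn
  have hU : IsOpen (I ×ˢ J) := hIo.prod hJo
  have hD : ∀ {F : ℝ × ℝ → ℝ}, ContDiffOn ℝ ∞ F (I ×ˢ J) → ∀ {x y}, x ∈ I → y ∈ J →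
      DifferentiableAt ℝ F (x, y) :=
    fun hF _ _ hx hy => (hF.contDiffAt (hU.mem_nhds ⟨hx, hy⟩)).differentiableAt (by simp)
  have slice : ∀ i j, ContDiffOn ℝ ∞ (fun x => A (x, y₀) i j) I := fun i j =>
    (hA i j).comp (s := I) (f := fun x : ℝ => (x, y₀)) (by fun_prop) fun x hx => ⟨hx, hy₀⟩
  -- the entry `a` depends on `φ` only
  have ha : ∀ q ∈ I ×ˢ J, A q 0 0 = A (q.1, y₀) 0 0 := by
    rintro ⟨x, y⟩ ⟨hx, hy⟩
    refine eq_of_hasDerivAt_zero hJo hJc (f := fun t => A (x, t) 0 0) (fun t ht => ?_) hy hy₀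
    have := hasDerivAt_dy (hD (hA 0 0) hx ht)
    rwa [(hP (x, t) ⟨hx, ht⟩).a_theta] at this
  set a₀ : ℝ → ℝ := fun x => A (x, y₀) 0 0 with ha₀
  have s₀ : ContDiffOn ℝ ∞ a₀ I := slice 0 0
  have s₁ := contDiffOn_deriv hIo s₀
  have s₂ := contDiffOn_deriv hIo s₁
  have h₀ : ∀ x ∈ I, HasDerivAt a₀ (deriv a₀ x) x := fun x => hasDerivAt_of_contDiffOn hIo s₀
  have h₁ : ∀ x ∈ I, HasDerivAt (deriv a₀) (deriv (deriv a₀) x) x :=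
    fun x => hasDerivAt_of_contDiffOn hIo s₁
  have h₂ : ∀ x ∈ I, HasDerivAt (deriv (deriv a₀)) (deriv (deriv (deriv a₀)) x) x :=
    fun x => hasDerivAt_of_contDiffOn hIo s₂
  have ax : ∀ x ∈ I, ∀ y ∈ J, dx (fun r => A r 0 0) (x, y) = deriv a₀ x := fun x hx y hy =>
    dx_eq_of_eqOn hU (G := fun q => a₀ q.1) ha ⟨hx, hy⟩ (hD (hA 0 0) hx hy) (h₀ x hx)
  have hd : ∀ q ∈ I ×ˢ J, A q 1 0 = -(deriv a₀ q.1 * (Real.cos q.2 / Real.sin q.2)) := by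
    rintro ⟨x, y⟩ ⟨hx, hy⟩
    have := (hP (x, y) ⟨hx, hy⟩).d_eq
    rw [ax x hx y hy] at this
    have hs' := hs y hy
    field_simp
    linarith
  have dX : ∀ x ∈ I, ∀ y ∈ J, dx (fun r => A r 1 0) (x, y)
      = -(deriv (deriv a₀) x * (Real.cos y / Real.sin y)) := fun x hx y hy =>
    dx_eq_of_eqOn hU hd ⟨hx, hy⟩ (hD (hA 1 0) hx hy)
      ((h₁ x hx).mul_const (Real.cos y / Real.sin y)).fun_neg
  have hR : ContDiffOn ℝ ∞ (curlLeft A) (I ×ˢ J) :=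
    (contDiffOn_dx hU (hA 1 0)).sub (contDiffOn_dy hU (hA 0 0))
  have Rx : ∀ x ∈ I, ∀ y ∈ J, dx (curlLeft A) (x, y)
      = -(deriv (deriv (deriv a₀)) x * (Real.cos y / Real.sin y)) := fun x hx y hy =>
    dx_eq_of_eqOn hU (G := fun q => -(deriv (deriv a₀) q.1 * (Real.cos q.2 / Real.sin q.2)))
      (fun q hq => by
        simp only [curlLeft]
        rw [(hP q hq).a_theta, sub_zero]
        exact dX q.1 hq.1 q.2 hq.2)
      ⟨hx, hy⟩ (hD hR hx hy) ((h₂ x hx).mul_const (Real.cos y / Real.sin y)).fun_neg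
  have h₃ : ∀ x ∈ I, deriv (deriv (deriv a₀)) x = -deriv a₀ x := by
    intro x hx
    have e₁ := (hP (x, y₀) ⟨hx, hy₀⟩).d_phi_phi
    have e₂ := (hP (x, y₀) ⟨hx, hy₀⟩).e_phi
    rw [ax x hx y₀ hy₀] at e₂
    rw [Rx x hx y₀ hy₀] at e₁
    have hs' := hs y₀ hy₀
    have hc' := hc y₀ hy₀
    refine mul_left_cancel₀ (mul_ne_zero (mul_ne_zero two_ne_zero hs') hc') ?_
    simp only at e₁ e₂
    field_simp at e₁
    linear_combination Real.cos y₀ * e₂ - e₁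
  -- hence `a + a''` is a constant, and `w = a - κ` satisfies `w'' = -w`
  set κ : ℝ := a₀ x₀ + deriv (deriv a₀) x₀ with hκ
  have hκ' : ∀ x ∈ I, a₀ x + deriv (deriv a₀) x = κ := fun x hx =>
    eq_of_hasDerivAt_zero hIo hIc (f := fun x => a₀ x + deriv (deriv a₀) x)
      (fun t ht => ((h₀ t ht).fun_add (h₂ t ht)).congr_deriv (by rw [h₃ t ht]; ring)) hx hx₀
  set w : ℝ → ℝ := fun x => a₀ x - κ with hw
  have hw₁ : deriv w = deriv a₀ := by
    funext x
    simp [hw]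
  have hw₂ : ∀ x ∈ I, deriv (deriv a₀) x = -w x := fun x hx => by
    simp only [hw]
    linarith [hκ' x hx]
  set E : ℝ → ℝ := fun x => (A (x, y₀) 1 1 - κ + w x) * Real.sin y₀ with hE
  have sw : ContDiffOn ℝ ∞ w I := s₀.sub contDiffOn_const
  have sE : ContDiffOn ℝ ∞ E I := (((slice 1 1).sub contDiffOn_const).add sw).mul contDiffOn_const
  have k₁ : ∀ x ∈ I, HasDerivAt E (deriv E x) x := fun x => hasDerivAt_of_contDiffOn hIo sE
  have k₂ : ∀ x ∈ I, HasDerivAt (deriv E) (deriv (deriv E) x) x :=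
    fun x => hasDerivAt_of_contDiffOn hIo (contDiffOn_deriv hIo sE)
  have he : ∀ q ∈ I ×ˢ J, A q 1 1 = κ - w q.1 + E q.1 * (Real.sin q.2)⁻¹ := by
    rintro ⟨x, y⟩ ⟨hx, hy⟩
    have : (A (x, y) 1 1 - κ + w x) * Real.sin y = E x := by
      refine eq_of_hasDerivAt_zero hJo hJc (f := fun t => (A (x, t) 1 1 - κ + w x) * Real.sin t)
        (fun t ht => ?_) hy hy₀
      have := (((hasDerivAt_dy (hD (hA 1 1) hx ht)).sub_const κ).add_const (w x)).fun_mul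
        (Real.hasDerivAt_sin t)
      refine this.congr_deriv ?_
      have e := (hP (x, t) ⟨hx, ht⟩).e_theta
      rw [dX x hx t ht, ha (x, t) ⟨hx, ht⟩, hw₂ x hx] at e
      have hs' := hs t ht
      simp only at e
      field_simp at e
      simp only [hw] at e ⊢
      linear_combination e
    have hs' := hs y hy
    simp only
    rw [← this]
    field_simp
    ring
  have ex : ∀ x ∈ I, ∀ y ∈ J, dx (fun r => A r 1 1) (x, y)
      = -deriv a₀ x + deriv E x * (Real.sin y)⁻¹ := fun x hx y hy =>
    dx_eq_of_eqOn hU he ⟨hx, hy⟩ (hD (hA 1 1) hx hy)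
      ((((h₀ x hx).sub_const κ).const_sub κ).fun_add ((k₁ x hx).mul_const (Real.sin y)⁻¹))
  have hb : ∀ q ∈ I ×ˢ J, A q 0 1 = -(deriv a₀ q.1 * (Real.sin q.2 / Real.cos q.2)
      + deriv E q.1 * (Real.cos q.2)⁻¹) := by
    rintro ⟨x, y⟩ ⟨hx, hy⟩
    have e := (hP (x, y) ⟨hx, hy⟩).e_phi
    rw [ex x hx y hy, ax x hx y hy] at e
    have hs' := hs y hy
    have hc' := hc y hy
    simp only at e ⊢
    field_simp at e ⊢
    linear_combination e
  have bx : ∀ x ∈ I, ∀ y ∈ J, dx (fun r => A r 0 1) (x, y)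
      = -(deriv (deriv a₀) x * (Real.sin y / Real.cos y)
        + deriv (deriv E) x * (Real.cos y)⁻¹) := fun x hx y hy =>
    dx_eq_of_eqOn hU hb ⟨hx, hy⟩ (hD (hA 0 1) hx hy)
      (((h₁ x hx).mul_const (Real.sin y / Real.cos y)).fun_add
        ((k₂ x hx).mul_const (Real.cos y)⁻¹)).fun_neg
  have ey : ∀ x ∈ I, ∀ y ∈ J, dy (fun r => A r 1 1) (x, y)
      = E x * (-Real.cos y / Real.sin y ^ 2) := fun x hx y hy =>
    dy_eq_of_eqOn hU he ⟨hx, hy⟩ (hD (hA 1 1) hx hy)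
      ((((Real.hasDerivAt_sin y).fun_inv (hs y hy)).const_mul (E x)).const_add (κ - w x))
  refine ⟨κ, w, E, sw, sE, fun x hx => ?_, fun x hx => ?_, fun q hq => ?_⟩
  · rw [hw₁, ← hw₂ x hx]
    exact h₁ x hx
  · have e := (hP (x, y₀) ⟨hx, hy₀⟩).compat
    have hq : (x, y₀) ∈ I ×ˢ J := ⟨hx, hy₀⟩
    rw [bx x hx y₀ hy₀, ex x hx y₀ hy₀, dX x hx y₀ hy₀, ey x hx y₀ hy₀, hb _ hq, hd _ hq,
      he _ hq, ha _ hq, hw₂ x hx] at e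
    have ha₀w : A (x, y₀) 0 0 = κ + w x := by simp [hw, ha₀]
    simp only at e
    rw [ha₀w] at e
    rw [hw₁]
    have hs' := hs y₀ hy₀
    have hc' := hc y₀ hy₀
    clear * - e hs' hc'
    generalize deriv a₀ x = a₁ at *
    generalize deriv (deriv E) x = E₂ at *
    generalize deriv E x = E₁ at *
    generalize E x = E₀ at *
    generalize w x = w₀ at *
    field_simp at e
    grind
  · ext i j
    fin_cases i <;> fin_cases j
    · simp [normalForm, hw, ha q hq, ha₀]
    · simpa [normalForm, hw₁] using hb q hq
    · simpa [normalForm, hw₁] using hd q hq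
    · simpa [normalForm] using he q hq

/-! ### The one-variable equations and the two families -/

/-- The oscillator equation `w'' = -w` has only sinusoidal solutions. -/
theorem exists_eq_mul_sin {I : Set ℝ} (hIo : IsOpen I) (hIc : I.OrdConnected)
    (hIn : I.Nonempty) {w w₁ : ℝ → ℝ} (hw : ∀ x ∈ I, HasDerivAt w (w₁ x) x)
    (hw₁ : ∀ x ∈ I, HasDerivAt w₁ (-w x) x) :
    ∃ c α : ℝ, ∀ x ∈ I, w x = c * Real.sin (x + α) ∧ w₁ x = c * Real.cos (x + α) := by
  obtain ⟨x₀, hx₀⟩ := hIn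
  -- rotating `(w', w)` by the angle `-x` gives a constant vector, whose polar form is `(c, α)`
  have hp : ∀ x ∈ I, w₁ x * Real.cos x + w x * Real.sin x
      = w₁ x₀ * Real.cos x₀ + w x₀ * Real.sin x₀ := fun x hx =>
    eq_of_hasDerivAt_zero hIo hIc (f := fun x => w₁ x * Real.cos x + w x * Real.sin x)
      (fun t ht => (((hw₁ t ht).fun_mul (Real.hasDerivAt_cos t)).fun_add
        ((hw t ht).fun_mul (Real.hasDerivAt_sin t))).congr_deriv (by ring)) hx hx₀
  have hr : ∀ x ∈ I, w x * Real.cos x - w₁ x * Real.sin x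
      = w x₀ * Real.cos x₀ - w₁ x₀ * Real.sin x₀ := fun x hx =>
    eq_of_hasDerivAt_zero hIo hIc (f := fun x => w x * Real.cos x - w₁ x * Real.sin x)
      (fun t ht => (((hw t ht).fun_mul (Real.hasDerivAt_cos t)).fun_sub
        ((hw₁ t ht).fun_mul (Real.hasDerivAt_sin t))).congr_deriv (by ring)) hx hx₀
  set u : ℂ := ⟨w₁ x₀ * Real.cos x₀ + w x₀ * Real.sin x₀,
    w x₀ * Real.cos x₀ - w₁ x₀ * Real.sin x₀⟩ with hu
  have h₁ : ‖u‖ * Real.cos u.arg = w₁ x₀ * Real.cos x₀ + w x₀ * Real.sin x₀ :=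
    Complex.norm_mul_cos_arg u
  have h₂ : ‖u‖ * Real.sin u.arg = w x₀ * Real.cos x₀ - w₁ x₀ * Real.sin x₀ :=
    Complex.norm_mul_sin_arg u
  refine ⟨‖u‖, u.arg, fun x hx => ?_⟩
  have e₁ := (hp x hx).trans h₁.symm
  have e₂ := (hr x hx).trans h₂.symm
  have hsc := Real.sin_sq_add_cos_sq x
  rw [Real.sin_add, Real.cos_add]
  constructor
  · linear_combination Real.sin x * e₁ + Real.cos x * e₂ - w x * hsc
  · linear_combination Real.cos x * e₁ - Real.sin x * e₂ - w₁ x * hsc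

/-- The quantities `E' cos - 2 E sin` and `E cos² - c₃ sin` are first integrals of the equation
for `E`; as they make sense where the cosine vanishes, the same constants serve on all of `I`. -/
theorem exists_first_integrals {I : Set ℝ} (hIo : IsOpen I) (hIc : I.OrdConnected)
    (hIn : I.Nonempty) {E E₁ E₂ : ℝ → ℝ} (hE : ∀ x ∈ I, HasDerivAt E (E₁ x) x)
    (hE₁ : ∀ x ∈ I, HasDerivAt E₁ (E₂ x) x) {α : ℝ}
    (hode : ∀ x ∈ I, Real.cos (x + α) * E₂ x - 3 * Real.sin (x + α) * E₁ x
      - 2 * Real.cos (x + α) * E x = 0) :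
    ∃ c₂ c₃ : ℝ, ∀ x ∈ I, E₁ x * Real.cos (x + α) - 2 * E x * Real.sin (x + α) = c₃ ∧
      E x * Real.cos (x + α) ^ 2 = c₃ * Real.sin (x + α) - c₂ / 2 := by
  obtain ⟨x₀, hx₀⟩ := hIn
  have hsin : ∀ x, HasDerivAt (fun t => Real.sin (t + α)) (Real.cos (x + α)) x := fun x =>
    (Real.hasDerivAt_sin (x + α)).comp_add_const x α
  have hcos : ∀ x, HasDerivAt (fun t => Real.cos (t + α)) (-Real.sin (x + α)) x := fun x =>
    (Real.hasDerivAt_cos (x + α)).comp_add_const x α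
  have h₃ : ∀ x ∈ I, E₁ x * Real.cos (x + α) - 2 * E x * Real.sin (x + α)
      = E₁ x₀ * Real.cos (x₀ + α) - 2 * E x₀ * Real.sin (x₀ + α) := fun x hx =>
    eq_of_hasDerivAt_zero hIo hIc
      (f := fun x => E₁ x * Real.cos (x + α) - 2 * E x * Real.sin (x + α))
      (fun t ht => (((hE₁ t ht).fun_mul (hcos t)).fun_sub
        (((hE t ht).const_mul 2).fun_mul (hsin t))).congr_deriv
          (by linear_combination hode t ht)) hx hx₀
  generalize E₁ x₀ * Real.cos (x₀ + α) - 2 * E x₀ * Real.sin (x₀ + α) = c₃ at h₃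
  have h₂ : ∀ x ∈ I, E x * Real.cos (x + α) ^ 2 - c₃ * Real.sin (x + α)
      = E x₀ * Real.cos (x₀ + α) ^ 2 - c₃ * Real.sin (x₀ + α) := fun x hx =>
    eq_of_hasDerivAt_zero hIo hIc
      (f := fun x => E x * Real.cos (x + α) ^ 2 - c₃ * Real.sin (x + α))
      (fun t ht => (((hE t ht).fun_mul ((hcos t).fun_pow 2)).fun_sub
        ((hsin t).const_mul c₃)).congr_deriv (by
          push_cast
          linear_combination Real.cos (t + α) * h₃ t ht)) hx hx₀
  refine ⟨-2 * (E x₀ * Real.cos (x₀ + α) ^ 2 - c₃ * Real.sin (x₀ + α)), c₃, fun x hx =>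
    ⟨h₃ x hx, ?_⟩⟩
  linear_combination h₂ x hx

theorem eq_familyOne {κ c₁ : ℝ} {f w w₁ E E₁ : ℝ → ℝ} {q : ℝ × ℝ} (hw : w q.1 = 0)
    (hw₁ : w₁ q.1 = 0) (hE : E q.1 = c₁ - f q.1) (hE₁ : E₁ q.1 = -deriv f q.1) :
    normalForm κ w w₁ E E₁ q = κ • (1 : Matrix (Fin 2) (Fin 2) ℝ) + familyOne f c₁ q := by
  ext i j
  fin_cases i <;> fin_cases j <;> simp [normalForm, familyOne, hw, hw₁, hE, hE₁, div_eq_mul_inv]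

theorem eq_familyTwo {κ α c₁ c₂ c₃ : ℝ} {w w₁ E E₁ : ℝ → ℝ} {x y : ℝ}
    (hx : Real.cos (x + α) ≠ 0) (hc : Real.cos y ≠ 0) (hs : Real.sin y ≠ 0)
    (hw : w x = c₁ * Real.sin (x + α)) (hw₁ : w₁ x = c₁ * Real.cos (x + α))
    (hE₁ : E₁ x * Real.cos (x + α) - 2 * E x * Real.sin (x + α) = c₃)
    (hE : E x * Real.cos (x + α) ^ 2 = c₃ * Real.sin (x + α) - c₂ / 2) :
    normalForm κ w w₁ E E₁ (x, y)
      = κ • (1 : Matrix (Fin 2) (Fin 2) ℝ) + familyTwo c₁ c₂ c₃ (x + α, y) := by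
  have hsc := Real.sin_sq_add_cos_sq (x + α)
  have hE' : E x = (c₃ * Real.sin (x + α) - c₂ / 2) / Real.cos (x + α) ^ 2 := by
    field_simp
    linear_combination 2 * hE
  have hE₁' : E₁ x = (c₃ + 2 * E x * Real.sin (x + α)) / Real.cos (x + α) := by
    field_simp
    linear_combination hE₁
  ext i j
  fin_cases i <;> fin_cases j
  · simp [normalForm, familyTwo, hw]
  · simp [normalForm, familyTwo, hw₁, hE₁', hE', Real.tan_eq_sin_div_cos]
    field_simp
    linear_combination (-2 * c₃) * hsc
  · simp [normalForm, familyTwo, hw₁, Real.cot_eq_cos_div_sin]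
    field_simp
  · simp [normalForm, familyTwo, hw, hE']
    field_simp
    ring

theorem hasDerivAt_secondFamily {α c₂ c₃ x : ℝ} (hx : Real.cos (x + α) ≠ 0) :
    HasDerivAt (fun t => (c₃ * Real.sin (t + α) - c₂ / 2) / Real.cos (t + α) ^ 2)
      ((c₃ + 2 * ((c₃ * Real.sin (x + α) - c₂ / 2) / Real.cos (x + α) ^ 2) * Real.sin (x + α))
        / Real.cos (x + α)) x := by
  have hsin : HasDerivAt (fun t => Real.sin (t + α)) (Real.cos (x + α)) x :=
    (Real.hasDerivAt_sin (x + α)).comp_add_const x α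
  have hcos : HasDerivAt (fun t => Real.cos (t + α)) (-Real.sin (x + α)) x :=
    (Real.hasDerivAt_cos (x + α)).comp_add_const x α
  refine (((hsin.const_mul c₃).sub_const (c₂ / 2)).fun_div (hcos.fun_pow 2)
    (pow_ne_zero 2 hx)).congr_deriv ?_
  push_cast
  field_simp
  ring

/-- The derivative of `E₁` is written in a form that makes the equation for `E` evident. -/
theorem hasDerivAt_deriv_secondFamily {α c₃ x : ℝ} {E E₁ : ℝ → ℝ} (hx : Real.cos (x + α) ≠ 0)
    (hE : HasDerivAt E (E₁ x) x)
    (hE₁ : E₁ = fun t => (c₃ + 2 * E t * Real.sin (t + α)) / Real.cos (t + α)) :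
    HasDerivAt E₁
      ((3 * E₁ x * Real.sin (x + α) + 2 * E x * Real.cos (x + α)) / Real.cos (x + α)) x := by
  have hsin : HasDerivAt (fun t => Real.sin (t + α)) (Real.cos (x + α)) x :=
    (Real.hasDerivAt_sin (x + α)).comp_add_const x α
  have hcos : HasDerivAt (fun t => Real.cos (t + α)) (-Real.sin (x + α)) x :=
    (Real.hasDerivAt_cos (x + α)).comp_add_const x α
  have h := (((hE.const_mul 2).fun_mul hsin).const_add c₃).fun_div hcos hx
  have he : E₁ x * Real.cos (x + α) = c₃ + 2 * E x * Real.sin (x + α) := by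
    rw [hE₁]
    field_simp
  rw [← he] at h
  rw [← hE₁] at h
  refine h.congr_deriv ?_
  field_simp
  ring

theorem continuousOn_schouten {D : Set Phase} (hD : IsOpen D) {P : BivectorField}
    (hP : ∀ i j, ContDiffOn ℝ ∞ (fun z => P z i j) D) (i j k : Fin 4) :
    ContinuousOn (fun z => schouten P P z i j k) D := by
  have hp : ∀ m a b, ContinuousOn (fun z => pderiv m (fun w => P w a b) z) D := fun m a b =>
    ((hP a b).continuousOn_fderiv_of_isOpen hD (by simp)).clm_apply continuousOn_const
  have hc : ∀ a b, ContinuousOn (fun z => P z a b) D := fun a b => (hP a b).continuousOn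
  refine ContinuousOn.neg (continuousOn_finsetSum _ fun m _ => ?_)
  exact (((hc m k).mul (hp m i j)).add ((hc m k).mul (hp m i j))).add
    (((hc m i).mul (hp m j k)).add ((hc m i).mul (hp m j k))) |>.add
    (((hc m j).mul (hp m k i)).add ((hc m j).mul (hp m k i)))

theorem eventually_cos_ne_zero (x α : ℝ) : ∀ᶠ t in 𝓝[≠] x, Real.cos (t + α) ≠ 0 := by
  have hcos : HasDerivAt (fun t => Real.cos (t + α)) (-Real.sin (x + α)) x :=
    (Real.hasDerivAt_cos (x + α)).comp_add_const x α
  by_cases h : Real.cos (x + α) = 0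
  · have hs : -Real.sin (x + α) ≠ 0 := fun hs => by
      have := Real.sin_sq_add_cos_sq (x + α)
      rw [h, neg_eq_zero.mp hs] at this
      norm_num at this
    exact hcos.eventually_ne hs
  · exact (hcos.continuousAt.eventually_ne h).filter_mono nhdsWithin_le_nhds

/-! ### Smoothness, continuation and the classification -/

theorem isOpen_phaseOver {I J : Set ℝ} (hIo : IsOpen I) (hJo : IsOpen J) :
    IsOpen (phaseOver I J) :=
  (hIo.preimage (continuous_apply 0)).inter (hJo.preimage (continuous_apply 1))

theorem contDiffOn_explicitPencil {A : ℝ × ℝ → Matrix (Fin 2) (Fin 2) ℝ}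
    {h : ℝ × ℝ → Fin 2 → ℝ} {I J : Set ℝ} (hIo : IsOpen I) (hJo : IsOpen J)
    (hc : ∀ y ∈ J, Real.cos y ≠ 0) (hs : ∀ y ∈ J, Real.sin y ≠ 0)
    (hA : ∀ i j, ContDiffOn ℝ ∞ (fun q => A q i j) (I ×ˢ J))
    (hh : ∀ i, ContDiffOn ℝ ∞ (fun q => h q i) (I ×ˢ J)) (l : ℝ) (i j : Fin 4) :
    ContDiffOn ℝ ∞ (fun z => explicitPencil A h l z i j) (phaseOver I J) := by
  have hU : IsOpen (I ×ˢ J) := hIo.prod hJo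
  have hD : ∀ z ∈ phaseOver I J, (z 0, z 1) ∈ I ×ˢ J := fun z hz => hz
  have k0 : ContDiffOn ℝ ∞ (fun _ : ℝ × ℝ => (0 : ℝ)) (I ×ˢ J) := contDiffOn_const
  have kc : ContDiffOn ℝ ∞ (fun q : ℝ × ℝ => Real.cos q.2) (I ×ˢ J) :=
    (Real.contDiff_cos.comp contDiff_snd).contDiffOn
  have ks : ContDiffOn ℝ ∞ (fun q : ℝ × ℝ => Real.sin q.2) (I ×ˢ J) :=
    (Real.contDiff_sin.comp contDiff_snd).contDiffOn
  have hc' : ∀ q ∈ I ×ˢ J, Real.cos q.2 ≠ 0 := fun q hq => hc q.2 hq.2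
  have hs' : ∀ q ∈ I ×ˢ J, Real.sin q.2 ≠ 0 := fun q hq => hs q.2 hq.2
  have hR : ContDiffOn ℝ ∞ (curlLeft A) (I ×ˢ J) :=
    (contDiffOn_dx hU (hA 1 0)).sub (contDiffOn_dy hU (hA 0 0))
  have hS : ContDiffOn ℝ ∞ (curlRight A) (I ×ˢ J) :=
    (contDiffOn_dx hU (hA 1 1)).sub (contDiffOn_dy hU (hA 0 1))
  have hu : ContDiffOn ℝ ∞ (curlForce h) (I ×ˢ J) :=
    (contDiffOn_dx hU (hh 1)).sub (contDiffOn_dy hU (hh 0))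
  have lin : ∀ {F : Phase → ℝ} (c : ℝ), ContDiffOn ℝ ∞ F (phaseOver I J) →
      ContDiffOn ℝ ∞ (fun z => c + l * F z) (phaseOver I J) := fun c hF =>
    contDiffOn_const.add (contDiffOn_const.mul hF)
  have q01 := lin 0 (contDiffOn_quad hD k0 (kc.inv hc') k0 k0 k0 k0)
  have q02 := lin 1 (contDiffOn_quad hD (hA 0 0).neg k0 k0 k0 k0 k0)
  have q03 := lin 0 (contDiffOn_quad hD (hA 1 0).neg k0 k0 k0
    (((kc.pow 2).mul ks).inv fun q hq => mul_ne_zero (pow_ne_zero 2 (hc' q hq)) (hs' q hq)).neg k0)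
  have q12 := lin 0 (contDiffOn_quad hD (hA 0 1).neg k0 k0 k0 k0 k0)
  have q13 := lin 1 (contDiffOn_quad hD (hA 1 1).neg k0 k0
    ((contDiffOn_const.mul ks).inv fun q hq => mul_ne_zero two_ne_zero (hs' q hq)).neg k0
    (ks.div (contDiffOn_const.mul (kc.pow 2))
      fun q hq => mul_ne_zero two_ne_zero (pow_ne_zero 2 (hc' q hq))).neg)
  have q23 := lin 0 (contDiffOn_quad hD hu hR hS k0 k0 k0)
  have z0 : ContDiffOn ℝ ∞ (fun _ : Phase => (0 : ℝ)) (phaseOver I J) := contDiffOn_const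
  fin_cases i <;> fin_cases j
  exacts [z0, q01, q02, q03, q01.neg, z0, q12, q13, q02.neg, q12.neg, z0, q23, q03.neg, q13.neg,
    q23.neg, z0]

/-- If the Schouten square of a smooth bivector over `I × J` vanishes wherever
`cos (φ + α) ≠ 0`, it vanishes everywhere. -/
theorem schouten_eq_zero_of_cos_ne_zero {I J : Set ℝ} (hIo : IsOpen I) (hJo : IsOpen J)
    {P : BivectorField} (hP : ∀ i j, ContDiffOn ℝ ∞ (fun z => P z i j) (phaseOver I J)) {α : ℝ}
    {i j k : Fin 4}
    (h : ∀ z ∈ phaseOver I J, Real.cos (z 0 + α) ≠ 0 → schouten P P z i j k = 0)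
    {z : Phase} (hz : z ∈ phaseOver I J) : schouten P P z i j k = 0 := by
  have hD := isOpen_phaseOver hIo hJo
  have hline : Continuous fun t : ℝ => Function.update z 0 t :=
    continuous_const.update 0 continuous_id
  have hupd : Function.update z 0 (z 0) = z := Function.update_eq_self 0 z
  have hcont : ContinuousAt (fun t => schouten P P (Function.update z 0 t) i j k) (z 0) := by
    refine ContinuousAt.comp (g := fun w => schouten P P w i j k) ?_ hline.continuousAt
    rw [hupd]
    exact (continuousOn_schouten hD hP i j k).continuousAt (hD.mem_nhds hz)
  have hlim : Tendsto (fun t => schouten P P (Function.update z 0 t) i j k) (𝓝[≠] (z 0))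
      (𝓝 (schouten P P z i j k)) := by
    simpa only [ContinuousAt, hupd] using hcont.tendsto.mono_left nhdsWithin_le_nhds
  have hmem : ∀ᶠ t in 𝓝[≠] (z 0), Function.update z 0 t ∈ phaseOver I J :=
    (hline.continuousAt.eventually_mem (by rw [hupd]; exact hD.mem_nhds hz)).filter_mono
      nhdsWithin_le_nhds
  have hzero : ∀ᶠ t in 𝓝[≠] (z 0), schouten P P (Function.update z 0 t) i j k = 0 := by
    filter_upwards [hmem, eventually_cos_ne_zero (z 0) α] with t h₁ h₂
    exact h _ h₁ (by simpa using h₂)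
  exact tendsto_nhds_unique hlim (tendsto_const_nhds.congr' (hzero.mono fun t ht => ht.symm))

end KowPencil

end

theorem proposition1 (I J : Set ℝ)
    (hIo : IsOpen I) (hIc : I.OrdConnected) (hIn : I.Nonempty)
    (hJo : IsOpen J) (hJc : J.OrdConnected) (hJn : J.Nonempty)
    (hJ : J ⊆ Set.Ioo 0 Real.pi) (hJ' : Real.pi / 2 ∉ J)
    (A : ℝ × ℝ → Matrix (Fin 2) (Fin 2) ℝ) (h : ℝ × ℝ → Fin 2 → ℝ)
    (hA : ∀ i j, ContDiffOn ℝ ∞ (fun q => A q i j) (I ×ˢ J))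
    (hh : ∀ i, ContDiffOn ℝ ∞ (fun q => h q i) (I ×ˢ J)) :
    (∀ l : ℝ, KowPencil.IsPoissonOn (KowPencil.phaseOver I J)
        (KowPencil.deformedPencil (KowPencil.potentialField A h) l)) ↔
      (∀ φ ∈ I, ∀ θ ∈ J, deriv (fun t => h (φ, t) 0) θ = deriv (fun t => h (t, θ) 1) φ) ∧
      ∃ κ : ℝ,
        (∃ (f : ℝ → ℝ) (c₁ : ℝ), ContDiffOn ℝ ∞ f I ∧
          ∀ φ ∈ I, ∀ θ ∈ J,
            A (φ, θ) = κ • (1 : Matrix (Fin 2) (Fin 2) ℝ) + KowPencil.familyOne f c₁ (φ, θ)) ∨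
        (∃ α c₁ c₂ c₃ : ℝ,
          ∀ φ ∈ I, ∀ θ ∈ J, Real.cos (φ + α) ≠ 0 →
            A (φ, θ) = κ • (1 : Matrix (Fin 2) (Fin 2) ℝ)
              + KowPencil.familyTwo c₁ c₂ c₃ (φ + α, θ)) := by
  have hs : ∀ y ∈ J, 0 < Real.sin y := fun y hy => Real.sin_pos_of_mem_Ioo (hJ hy)
  have hs' : ∀ y ∈ J, Real.sin y ≠ 0 := fun y hy => (hs y hy).ne'
  have hc : ∀ y ∈ J, Real.cos y ≠ 0 := fun y hy h0 => hJ' (by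
    have : y = Real.pi / 2 := Real.injOn_cos ⟨(hJ hy).1.le, (hJ hy).2.le⟩
      ⟨by positivity, by linarith [Real.pi_pos]⟩ (by rw [h0, Real.cos_pi_div_two])
    exact this ▸ hy)
  have hU : IsOpen (I ×ˢ J) := hIo.prod hJo
  have hD := KowPencil.isOpen_phaseOver hIo hJo
  have hdiff : ∀ {F : ℝ × ℝ → ℝ}, ContDiffOn ℝ ∞ F (I ×ˢ J) → ∀ {q}, q ∈ I ×ˢ J →
      DifferentiableAt ℝ F q :=
    fun hF q hq => (hF.contDiffAt (hU.mem_nhds hq)).differentiableAt (by simp)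
  have heq : ∀ l, ∀ z ∈ KowPencil.phaseOver I J,
      KowPencil.deformedPencil (KowPencil.potentialField A h) l z
        = KowPencil.explicitPencil A h l z := fun l z hz =>
    KowPencil.deformedPencil_eq_explicitPencil (fun i j => hdiff (hA i j) hz)
      (fun i => hdiff (hh i) hz) (hc _ hz.2) (hs _ hz.2) l
  have hsch : ∀ l, ∀ z ∈ KowPencil.phaseOver I J, ∀ i j k,
      KowPencil.schouten (KowPencil.deformedPencil (KowPencil.potentialField A h) l)
        (KowPencil.deformedPencil (KowPencil.potentialField A h) l) z i j k
      = KowPencil.schouten (KowPencil.explicitPencil A h l)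
        (KowPencil.explicitPencil A h l) z i j k := fun l z hz =>
    KowPencil.schouten_congr (Filter.mem_of_superset (hD.mem_nhds hz) (heq l))
  have hcurl : ∀ φ ∈ I, ∀ θ ∈ J, KowPencil.curlForce h (φ, θ)
      = deriv (fun t => h (t, θ) 1) φ - deriv (fun t => h (φ, t) 0) θ := fun φ hφ θ hθ => by
    rw [(KowPencil.hasDerivAt_dx (hdiff (hh 1) ⟨hφ, hθ⟩)).deriv,
      (KowPencil.hasDerivAt_dy (hdiff (hh 0) ⟨hφ, hθ⟩)).deriv, KowPencil.curlForce]
  have hsmooth := KowPencil.contDiffOn_explicitPencil hIo hJo hc hs' hA hh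
  constructor
  · intro hP
    have hE : ∀ q ∈ I ×ˢ J, KowPencil.PencilEquations A h q := fun q hq =>
      KowPencil.pencilEquations_of_schouten hU hA hh hq (hc _ hq.2) (hs' _ hq.2)
        fun z hz i j k => (hsch 1 z hz i j k).symm.trans ((hP 1).2.2 z hz i j k)
    refine ⟨fun φ hφ θ hθ => ?_, ?_⟩
    · have := (hE (φ, θ) ⟨hφ, hθ⟩).curl
      rw [hcurl φ hφ θ hθ] at this
      linarith
    obtain ⟨κ, w, E, sw, sE, hw₁, hode, hnf⟩ :=
      KowPencil.exists_normalForm hIo hIc hIn hJo hJc hJn hc hs' hA hE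
    obtain ⟨c₁, α, hcα⟩ := KowPencil.exists_eq_mul_sin hIo hIc hIn
      (fun x => KowPencil.hasDerivAt_of_contDiffOn hIo sw) hw₁
    refine ⟨κ, ?_⟩
    -- `w = 0` leaves `E` free; otherwise the equation for `E` can be divided by `c₁`
    by_cases h₁ : c₁ = 0
    · refine Or.inl ⟨fun x => -E x, 0, sE.neg, fun φ hφ θ hθ => ?_⟩
      rw [hnf (φ, θ) ⟨hφ, hθ⟩]
      exact KowPencil.eq_familyOne (by simp [(hcα φ hφ).1, h₁]) (by simp [(hcα φ hφ).2, h₁])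
        (by simp) (by simp)
    · obtain ⟨c₂, c₃, hfi⟩ := KowPencil.exists_first_integrals hIo hIc hIn (α := α)
        (fun x => KowPencil.hasDerivAt_of_contDiffOn hIo sE)
        (fun x => KowPencil.hasDerivAt_of_contDiffOn hIo (KowPencil.contDiffOn_deriv hIo sE))
        (fun x hx => mul_left_cancel₀ h₁ (by
          have := hode x hx
          rw [(hcα x hx).1, (hcα x hx).2] at this
          linear_combination this))
      refine Or.inr ⟨α, c₁, c₂, c₃, fun φ hφ θ hθ hφα => ?_⟩
      rw [hnf (φ, θ) ⟨hφ, hθ⟩]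
      exact KowPencil.eq_familyTwo hφα (hc θ hθ) (hs' θ hθ) (hcα φ hφ).1 (hcα φ hφ).2
        (hfi φ hφ).1 (hfi φ hφ).2
  · rintro ⟨hcurl', κ, hfam⟩ l
    have hu : ∀ q ∈ I ×ˢ J, KowPencil.curlForce h q = 0 := by
      rintro ⟨φ, θ⟩ ⟨hφ, hθ⟩
      rw [hcurl φ hφ θ hθ, hcurl' φ hφ θ hθ, sub_self]
    refine ⟨fun i j => (hsmooth l i j).congr fun z hz => by rw [heq l z hz], fun z hz i j => ?_,
      fun z hz i j k => ?_⟩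
    · rw [heq l z hz]
      exact KowPencil.explicitPencil_skew A h l z i j
    rw [hsch l z hz]
    rcases hfam with ⟨f, c₁, hf, hA₁⟩ | ⟨α, c₁, c₂, c₃, hA₂⟩
    · have hf₁ : ∀ x ∈ I, HasDerivAt f (deriv f x) x := fun x =>
        KowPencil.hasDerivAt_of_contDiffOn hIo hf
      have hf₂ : ∀ x ∈ I, HasDerivAt (deriv f) (deriv (deriv f) x) x := fun x =>
        KowPencil.hasDerivAt_of_contDiffOn hIo (KowPencil.contDiffOn_deriv hIo hf)
      exact KowPencil.schouten_explicitPencil_eq_zero hU hA hh (fun q hq => hc _ hq.2)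
        (fun q hq => hs' _ hq.2) hu (κ := κ) (w := fun _ => 0) (w₁ := fun _ => 0)
        (E := fun x => c₁ - f x) (E₁ := fun x => -deriv f x) (E₂ := fun x => -deriv (deriv f) x)
        (fun q hq => (hA₁ q.1 hq.1 q.2 hq.2).trans (KowPencil.eq_familyOne rfl rfl rfl rfl).symm)
        (fun q _ => hasDerivAt_const q.1 0) (fun q _ => by simpa using hasDerivAt_const q.1 (0 : ℝ))
        (fun q hq => (hf₁ q.1 hq.1).const_sub c₁) (fun q hq => (hf₂ q.1 hq.1).fun_neg)
        (fun q _ => by ring) hz l i j k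
    · refine KowPencil.schouten_eq_zero_of_cos_ne_zero hIo hJo (hsmooth l) (α := α)
        (fun z hz hzα => ?_) hz
      set V : Set (ℝ × ℝ) := (I ×ˢ J) ∩ {q | Real.cos (q.1 + α) ≠ 0} with hV
      have hVo : IsOpen V := hU.inter (isOpen_ne_fun (by fun_prop) continuous_const)
      have hVU : V ⊆ I ×ˢ J := Set.inter_subset_left
      set E : ℝ → ℝ := fun t => (c₃ * Real.sin (t + α) - c₂ / 2) / Real.cos (t + α) ^ 2 with hE
      set E₁ : ℝ → ℝ := fun t => (c₃ + 2 * E t * Real.sin (t + α)) / Real.cos (t + α) with hE₁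
      have hEE₁ : ∀ q ∈ V, HasDerivAt E (E₁ q.1) q.1 := fun q hq =>
        KowPencil.hasDerivAt_secondFamily hq.2
      refine KowPencil.schouten_explicitPencil_eq_zero hVo (fun i j => (hA i j).mono hVU)
        (fun i => (hh i).mono hVU) (fun q hq => hc _ hq.1.2) (fun q hq => hs' _ hq.1.2)
        (fun q hq => hu q hq.1) (κ := κ) (w := fun t => c₁ * Real.sin (t + α))
        (w₁ := fun t => c₁ * Real.cos (t + α)) (E := E) (E₁ := E₁)
        (E₂ := fun t => (3 * E₁ t * Real.sin (t + α) + 2 * E t * Real.cos (t + α))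
          / Real.cos (t + α))
        (fun q hq => (hA₂ q.1 hq.1.1 q.2 hq.1.2 hq.2).trans (KowPencil.eq_familyTwo hq.2
          (hc _ hq.1.2) (hs' _ hq.1.2) rfl rfl ?_ ?_).symm)
        (fun q _ => ((Real.hasDerivAt_sin (q.1 + α)).comp_add_const q.1 α).const_mul c₁)
        (fun q _ => (((Real.hasDerivAt_cos (q.1 + α)).comp_add_const q.1 α).const_mul
          c₁).congr_deriv (by ring)) hEE₁
        (fun q hq => KowPencil.hasDerivAt_deriv_secondFamily hq.2 (hEE₁ q hq) hE₁)
        (fun q hq => ?_) ⟨hz, hzα⟩ l i j k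
      · have : Real.cos (q.1 + α) ≠ 0 := hq.2
        simp only [hE₁]
        field_simp
        ring
      · have : Real.cos (q.1 + α) ≠ 0 := hq.2
        simp only [hE]
        field_simp
      · have : Real.cos (q.1 + α) ≠ 0 := hq.2
        field_simp
        ring
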